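/- **Theorem 5 (optimal TGCP map).** Write $J=\begin{pmatrix}0&1\\-1&0\end{pmatrix}$, $\mathcal J=J\oplus J$, $Z=\mathrm{diag}(1,-1)$. Let $V=\begin{pmatrix}A&C\\C^T&B\end{pmatrix}$ be the real $4\times4$ correlation matrix (CM) of a two-mode Gaussian state with zero displacement, shared by Alice (first mode) and Bob (second mode), so $V+i\mathcal J\ge0$, and suppose that the state is entangled, i.e. the lowest symplectic eigenvalue of the partially transposed CM $\Lambda V\Lambda$, $\Lambda=Z\oplus I$, is smaller than $1$. A one-mode trace-preserving Gaussian completely positive (TGCP) map is a pair $(S,G)$ of real $2\times2$ matrices with $G+iJ-iSJS^T\ge0$; a local TGCP map is a pair $(S_a,G_a),(S_b,G_b)$ of such maps, acting by $V\mapsto SVS^T+G$ with $S=S_a\oplus S_b$, $G=G_a\oplus G_b$. It is local symplectic if $G=0$ and $S_kJS_k^T=J$ for $k=a,b$. The attenuation of one mode with transmissivity $\tau\in[0,1]$ is the one-mode map $(\tau I,(1-\tau^2)I)$. The fidelity of teleportation of coherent states is $\mathcal F(V)=2/\sqrt{\det(2I+N)}$ with $N=ZAZ+ZC+C^TZ+B$,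 and a local TGCP map is called optimal if it maximizes the fidelity of the transformed CM among all local TGCP maps. For $\eta>0$, a CM is in the normal form $V_\eta$, with coefficients $n,m,d$ and $\lambda\in\mathbb R$, if $$A=\mathrm{diag}(n+\lambda,\,n),\qquad C=\mathrm{diag}(-d-\lambda/\eta,\,d),\qquad B=\mathrm{diag}(m+\lambda/\eta^2,\,m),$$ where $n,\ n+\lambda,\ m,\ m+\lambda/\eta^2,\ d,\ d+\lambda/\eta$ are all positive. Then: 1. An optimal map exists, and one is of the following canonical form: a local symplectic map, followed by an attenuation with transmissivity $0<\eta\le1$ on one of the two modes (no attenuation if $\eta=1$), where, if the attenuated mode is called Bob's (exchanging the names of the modes if necessary), the symplectic map brings the CM into a normal form $V_\eta$ with the same $\eta$, and $\eta=d/(m-1)$ if $\eta<1$. Every optimal map is of this form followed by a phase rotation by some angle $-\theta$ at Alice and $\theta$ at Bob (which does not change the fidelity). 2. If for some $0<\tau<1$ a local symplectic map $\sigma$ brings the CM into a normal form $V_\tau$ whose coefficients satisfy $$\tau=\frac{d}{m-1},$$ then $\sigma$ followed by the attenuation of Bob's mode with transmissivity $\tau$ is optimal, and no local symplectic map is optimal.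 The same holds with the roles of the two modes exchanged (the attenuation then being on Alice's mode). 3. If no such $\tau\in(0,1)$ exists, neither for the CM nor for the CM with the two modes exchanged, then the CM can be brought into the normal form $V_1$ by a local symplectic map, every local symplectic map that does so is optimal, and every optimal map is such a map followed by a phase rotation by some angle $-\theta$ at Alice and $\theta$ at Bob. -/

import Mathlib

open Matrix
open scoped ComplexOrder

namespace GaussianTeleportation

/-- Real matrices on the phase space of one mode, with coordinates `(x, p)`. -/
abbrev Mat2 := Matrix (Fin 2) (Fin 2) ℝ

/-- Real matrices on the phase space of two modes, Alice (`Sum.inl`) and Bob (`Sum.inr`). -/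
abbrev Mat4 := Matrix (Fin 2 ⊕ Fin 2) (Fin 2 ⊕ Fin 2) ℝ

/-- A real matrix regarded as a complex matrix. -/
abbrev toC {ι : Type} (A : Matrix ι ι ℝ) : Matrix ι ι ℂ := A.map Complex.ofReal

/-- The symplectic form of one mode. -/
def J : Mat2 := !![0, 1; -1, 0]

/-- The matrix `Z = diag(1, -1)`. -/
def Z : Mat2 := !![1, 0; 0, -1]

/-- The symplectic form of two modes, `J ⊕ J`. -/
def JJ : Mat4 := fromBlocks J 0 0 J

/-- `V` is the correlation matrix of a two-mode Gaussian state (normalized so that the vacuum has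
correlation matrix `1`): the uncertainty principle `V + i (J ⊕ J) ≥ 0`. Positive semidefiniteness
includes hermiticity, so `V` is symmetric. -/
def IsCM (V : Mat4) : Prop := (toC V + Complex.I • toC JJ).PosSemidef

/-- The correlation matrix of the partially transposed state: `Λ V Λ` with `Λ = Z ⊕ 1`. -/
def partialTranspose (V : Mat4) : Mat4 := fromBlocks Z 0 0 1 * V * fromBlocks Z 0 0 1

/-- `ν ≥ 0` is a symplectic eigenvalue of the partially transposed state, that is, `i ν` is an
eigenvalue of `(J ⊕ J) Λ V Λ`. -/
def IsPTSymplecticEigenvalue (V : Mat4) (ν : ℝ) : Prop :=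
  0 ≤ ν ∧ (toC (JJ * partialTranspose V)
    - (Complex.I * (ν : ℂ)) • (1 : Matrix (Fin 2 ⊕ Fin 2) (Fin 2 ⊕ Fin 2) ℂ)).det = 0

/-- The two-mode Gaussian state with correlation matrix `V` is entangled: the lowest symplectic
eigenvalue of the partially transposed state is smaller than `1`. -/
def IsEntangled (V : Mat4) : Prop := ∃ ν : ℝ, IsPTSymplecticEigenvalue V ν ∧ ν < 1

/-- The noise matrix `N = Z A Z + Z C + Cᵀ Z + B` of the teleportation channel, where
`V = [[A, C], [Cᵀ, B]]`. -/
def noise (V : Mat4) : Mat2 :=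
  Z * V.toBlocks₁₁ * Z + Z * V.toBlocks₁₂ + V.toBlocks₂₁ * Z + V.toBlocks₂₂

/-- The fidelity of teleportation of a one-mode Gaussian state with correlation matrix `Vin`
through the shared state with correlation matrix `V`. -/
noncomputable def gaussianFidelity (Vin : Mat2) (V : Mat4) : ℝ :=
  2 / Real.sqrt ((2 : ℝ) • Vin + noise V).det

/-- The fidelity of teleportation of coherent states. -/
noncomputable def fidelity (V : Mat4) : ℝ := gaussianFidelity 1 V

/-- A one-mode trace-preserving Gaussian completely positive map, acting on correlation matrices
as `V ↦ S V Sᵀ + G`. -/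
@[ext]
structure TGCP where
  S : Mat2
  G : Mat2
  cp : (toC G + Complex.I • toC J - Complex.I • toC (S * J * Sᵀ)).PosSemidef

lemma toC_mul (A B : Mat2) : toC (A * B) = toC A * toC B := by
  simp only [toC]
  exact Matrix.map_mul (f := Complex.ofRealHom)

lemma toC_add (A B : Mat2) : toC (A + B) = toC A + toC B := by
  ext i j; simp [toC]

lemma toC_conj (A : Mat2) : (toC A)ᴴ = toC Aᵀ := by
  ext i j; simp [toC, Matrix.conjTranspose_apply]

/-- Composition: first `g`, then `f`. -/
def TGCP.comp (f g : TGCP) : TGCP where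
  S := f.S * g.S
  G := f.S * g.G * f.Sᵀ + f.G
  cp := by
    have h := (g.cp.mul_mul_conjTranspose_same (toC f.S)).add f.cp
    convert h using 1
    simp only [toC_add, toC_conj, toC_mul, Matrix.transpose_mul, mul_add, add_mul, mul_sub,
      sub_mul, Matrix.mul_assoc, Matrix.mul_smul, Matrix.smul_mul]
    abel

/-- The symplectic (noiseless) one-mode map with matrix `S`. -/
def TGCP.ofSymplectic (S : Mat2) (h : S * J * Sᵀ = J) : TGCP where
  S := S
  G := 0
  cp := by
    rw [h]
    have : toC (0 : Mat2) + Complex.I • toC J - Complex.I • toC J = 0 := by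
      ext i j; simp [toC]
    rw [this]
    exact Matrix.PosSemidef.zero

/-- The identity map. -/
def TGCP.id : TGCP := TGCP.ofSymplectic 1 (by simp)

lemma one_add_J_posSemidef :
    ((1 : Matrix (Fin 2) (Fin 2) ℂ) + Complex.I • toC J).PosSemidef := by
  have h := Matrix.posSemidef_self_mul_conjTranspose
    (!![1, 0; -Complex.I, 0] : Matrix (Fin 2) (Fin 2) ℂ)
  convert h using 1
  ext i j
  fin_cases i <;> fin_cases j <;> simp [toC, J, Matrix.mul_apply, Matrix.conjTranspose_apply]

/-- The attenuation with transmissivity `τ` (a beam splitter with the vacuum at its other port):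
`a ↦ τ a + √(1 - τ²) a_vac`. -/
noncomputable def TGCP.attenuation (τ : ℝ) (hτ : τ ∈ Set.Icc (0 : ℝ) 1) : TGCP where
  S := τ • (1 : Mat2)
  G := (1 - τ ^ 2) • (1 : Mat2)
  cp := by
    have h0 : (0 : ℝ) ≤ 1 - τ ^ 2 := by nlinarith [hτ.1, hτ.2]
    have h1 : (0 : ℂ) ≤ ((1 - τ ^ 2 : ℝ) : ℂ) := by exact_mod_cast h0
    have h := one_add_J_posSemidef.smul h1
    convert h using 1
    ext i j
    fin_cases i <;> fin_cases j <;>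
      simp [toC, J, Matrix.mul_apply, Fin.sum_univ_two, Matrix.one_apply] <;> ring

/-- A local trace-preserving Gaussian completely positive map on two modes: a pair of one-mode
maps, one on Alice's mode and one on Bob's mode. -/
@[ext]
structure LocalTGCP where
  alice : TGCP
  bob : TGCP

namespace LocalTGCP

/-- The action on two-mode correlation matrices:
`V ↦ (S_a ⊕ S_b) V (S_a ⊕ S_b)ᵀ + (G_a ⊕ G_b)`. -/
def apply (ω : LocalTGCP) (V : Mat4) : Mat4 :=
  fromBlocks ω.alice.S 0 0 ω.bob.S * V * (fromBlocks ω.alice.S 0 0 ω.bob.S)ᵀ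
    + fromBlocks ω.alice.G 0 0 ω.bob.G

/-- Composition: first `g`, then `f`. -/
def comp (f g : LocalTGCP) : LocalTGCP := ⟨f.alice.comp g.alice, f.bob.comp g.bob⟩

/-- `ω` is a local symplectic (unitary Gaussian) map. -/
def IsSymplectic (ω : LocalTGCP) : Prop :=
  (ω.alice.S * J * ω.alice.Sᵀ = J ∧ ω.alice.G = 0) ∧
    (ω.bob.S * J * ω.bob.Sᵀ = J ∧ ω.bob.G = 0)

/-- Attenuation of Alice's mode only. -/
noncomputable def attenuateAlice (τ : ℝ) (hτ : τ ∈ Set.Icc (0 : ℝ) 1) : LocalTGCP :=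
  ⟨TGCP.attenuation τ hτ, TGCP.id⟩

/-- Attenuation of Bob's mode only. -/
noncomputable def attenuateBob (τ : ℝ) (hτ : τ ∈ Set.Icc (0 : ℝ) 1) : LocalTGCP :=
  ⟨TGCP.id, TGCP.attenuation τ hτ⟩

/-- The rotation by the angle `θ` of the phase space of one mode. -/
noncomputable def rotation (θ : ℝ) : TGCP :=
  TGCP.ofSymplectic !![Real.cos θ, -Real.sin θ; Real.sin θ, Real.cos θ] (by
    ext i j
    fin_cases i <;> fin_cases j <;>
      simp [J, Matrix.mul_apply, Fin.sum_univ_two] <;>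
      nlinarith [Real.sin_sq_add_cos_sq θ])

/-- Opposite phase rotations of the two modes, by `-θ` at Alice and by `θ` at Bob. This turns the
noise matrix `N` into `R_θ N R_θᵀ`, so it does not change the fidelity. -/
noncomputable def phaseRotation (θ : ℝ) : LocalTGCP := ⟨rotation (-θ), rotation θ⟩

end LocalTGCP

/-- `ω` maximizes the fidelity of teleportation of coherent states among all local
trace-preserving Gaussian completely positive maps. -/
def IsOptimal (V : Mat4) (ω : LocalTGCP) : Prop :=
  ∀ ω' : LocalTGCP, fidelity (ω'.apply V) ≤ fidelity (ω.apply V)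

/-- `V` is in the normal form `V_η` with coefficients `n, m, d, lam`: it has the entries
`n₁ = n + lam`, `n₂ = n`, `m₁ = m + lam/η²`, `m₂ = m`, `d₁ = d + lam/η`, `d₂ = d`, which are all
positive. -/
structure IsNormalForm (η n m d lam : ℝ) (V : Mat4) : Prop where
  n1_pos : 0 < n + lam
  n2_pos : 0 < n
  m1_pos : 0 < m + lam / η ^ 2
  m2_pos : 0 < m
  d1_pos : 0 < d + lam / η
  d2_pos : 0 < d
  eq : V = fromBlocks
    !![n + lam, 0; 0, n] !![-d - lam / η, 0; 0, d]
    !![-d - lam / η, 0; 0, d] !![m + lam / η ^ 2, 0; 0, m]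

/-- The correlation matrix after exchanging the names of the two modes. -/
def swapModes (V : Mat4) : Mat4 := V.submatrix Sum.swap Sum.swap

/-- The local symplectic map `σ` brings `V` into a normal form `V_τ` whose coefficients satisfy
`τ = d / (m - 1)`. -/
def SolvesRelation (V : Mat4) (τ : ℝ) (σ : LocalTGCP) : Prop :=
  σ.IsSymplectic ∧ ∃ n m d lam : ℝ, IsNormalForm τ n m d lam (σ.apply V) ∧ τ = d / (m - 1)

/-- The same with the roles of the two modes exchanged. -/
def SolvesRelationSwapped (V : Mat4) (τ : ℝ) (σ : LocalTGCP) : Prop :=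
  σ.IsSymplectic ∧
    ∃ n m d lam : ℝ, IsNormalForm τ n m d lam (swapModes (σ.apply V)) ∧ τ = d / (m - 1)

/-- The local symplectic map `σ` brings `V` into the normal form `V_1`. -/
def ReachesV1 (V : Mat4) (σ : LocalTGCP) : Prop :=
  σ.IsSymplectic ∧ ∃ n m d lam : ℝ, IsNormalForm 1 n m d lam (σ.apply V)

/-- `κ = α ∘ σ`, where `σ` is local symplectic and `α` is an attenuation of Bob's mode with
transmissivity `0 < η ≤ 1` (no attenuation if `η = 1`), `σ` brings `V` into the normal form `V_η`,
and `η = d / (m - 1)` if `η < 1`; or the same with the roles of the two modes exchanged. -/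
def IsCanonical (V : Mat4) (κ : LocalTGCP) : Prop :=
  ∃ (σ : LocalTGCP) (η n m d lam : ℝ) (h0 : 0 < η) (h1 : η ≤ 1),
    σ.IsSymplectic ∧ (η < 1 → η = d / (m - 1)) ∧
      ((IsNormalForm η n m d lam (σ.apply V) ∧
          κ = (LocalTGCP.attenuateBob η ⟨h0.le, h1⟩).comp σ) ∨
        (IsNormalForm η n m d lam (swapModes (σ.apply V)) ∧
          κ = (LocalTGCP.attenuateAlice η ⟨h0.le, h1⟩).comp σ))

end GaussianTeleportation

namespace GaussianTeleportation

/-! The problem reduces to minimizing a function of two matrices. For a local map with matrices `S`,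
`T`, the noise is the bare noise of `(S, T)` plus the added noises. Complete positivity bounds the
square roots of the determinants of the added noises below by `|1 - det S|` and `|1 - det T|`. By
Minkowski's determinant inequality and AM-GM, the fidelity is largest when every contribution is
least and scalar. A congruence of determinant one makes the bare noise scalar without changing `det
S` and `det T`. So optimal maps are the minimizers of `cost`, with the noise then dictated
(`isOptimal_iff`); a minimizer exists because the half trace is a positive definite quadratic form.

Along a ray `(√k S, √k T)` the determinants and the half trace are linear in `k`. Uncertainty and
entanglement then force one determinant to be `1` and the other to lie in `(0, 1]`
(`det_of_minimal`). A local symplectic map moves the minimizer to `(1, η)`, and the first order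
conditions there, with a rotation that diagonalizes the correlations, are exactly the normal form
`V_η`. Its Lagrange multipliers are `α = n - η d` and `β = m - d / η`; if `η < 1`, varying `η` gives
`β = 1`, which is `η = d / (m - 1)`.

Conversely, when `β = 1` and `η < 1`, the half trace is at least `α det S + det T`, and this makes
`(1, η)` a global minimum that no pair of determinants one attains (`cost_lower_bound`).

If the relation has no solution, the canonical optimal map is symplectic and reaches `V_1`. Every
map to `V_1` has cost `α + β`, and this sum is fixed by the local symplectic invariants, since two
forms `V_1` of one state could differ only by local squeezings, which turn out to be trivial
(`critical_squeezing_trivial`). -/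

lemma Z_mul_Z : Z * Z = 1 := by
  ext i j; fin_cases i <;> fin_cases j <;> simp [Z]

lemma Z_transpose : Zᵀ = Z := by
  ext i j; fin_cases i <;> fin_cases j <;> simp [Z]

lemma mul_J_mul_transpose (S : Mat2) : S * J * Sᵀ = S.det • J := by
  ext i j
  fin_cases i <;> fin_cases j <;>
    simp [J, Matrix.mul_apply, Fin.sum_univ_two, Matrix.det_fin_two] <;> ring

lemma mul_J_mul_transpose_eq_J_iff (S : Mat2) : S * J * Sᵀ = J ↔ S.det = 1 := by
  rw [mul_J_mul_transpose]
  constructor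
  · intro h
    have := congrFun (congrFun h 0) 1
    simpa [J] using this
  · intro h; rw [h, one_smul]

/-! ### Bare noise, half trace and cost -/

/-- The noise matrix of the teleportation channel after the transformation `S ⊕ T`, without the
noise that the local maps add. -/
def bareNoise (V : Mat4) (S T : Mat2) : Mat2 :=
  Z * S * V.toBlocks₁₁ * Sᵀ * Z + Z * S * V.toBlocks₁₂ * Tᵀ
    + T * V.toBlocks₂₁ * Sᵀ * Z + T * V.toBlocks₂₂ * Tᵀ

lemma LocalTGCP.apply_eq (ω : LocalTGCP) (V : Mat4) :
    ω.apply V = fromBlocks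
      (ω.alice.S * V.toBlocks₁₁ * ω.alice.Sᵀ + ω.alice.G) (ω.alice.S * V.toBlocks₁₂ * ω.bob.Sᵀ)
      (ω.bob.S * V.toBlocks₂₁ * ω.alice.Sᵀ) (ω.bob.S * V.toBlocks₂₂ * ω.bob.Sᵀ + ω.bob.G) := by
  conv_lhs => rw [← fromBlocks_toBlocks V]
  simp [LocalTGCP.apply, fromBlocks_multiply, fromBlocks_transpose, fromBlocks_add]

lemma noise_apply (ω : LocalTGCP) (V : Mat4) :
    noise (ω.apply V)
      = bareNoise V ω.alice.S ω.bob.S + Z * ω.alice.G * Z + ω.bob.G := by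
  rw [LocalTGCP.apply_eq]
  simp only [noise, bareNoise, toBlocks_fromBlocks₁₁, toBlocks_fromBlocks₁₂,
    toBlocks_fromBlocks₂₁, toBlocks_fromBlocks₂₂]
  noncomm_ring

lemma bareNoise_apply (ω : LocalTGCP) (hω : ω.IsSymplectic) (V : Mat4) (S T : Mat2) :
    bareNoise (ω.apply V) S T = bareNoise V (S * ω.alice.S) (T * ω.bob.S) := by
  rw [LocalTGCP.apply_eq, hω.1.2, hω.2.2]
  simp only [bareNoise, toBlocks_fromBlocks₁₁, toBlocks_fromBlocks₁₂,
    toBlocks_fromBlocks₂₁, toBlocks_fromBlocks₂₂, Matrix.transpose_mul, add_zero]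
  simp only [Matrix.mul_assoc]

lemma bareNoise_mul_left (V : Mat4) (R S T : Mat2) :
    bareNoise V (Z * R * Z * S) (R * T) = R * bareNoise V S T * Rᵀ := by
  have h : ∀ M : Mat2, Z * (Z * M) = M := fun M => by
    rw [← Matrix.mul_assoc, Z_mul_Z, Matrix.one_mul]
  simp only [bareNoise, Matrix.transpose_mul, Matrix.mul_add, Matrix.add_mul, Matrix.mul_assoc,
    Z_transpose, h, Z_mul_Z, Matrix.mul_one]

/-- Half the trace of the bare noise matrix. -/
noncomputable def halfTrace (V : Mat4) (S T : Mat2) : ℝ := (bareNoise V S T).trace / 2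

/-- The quadratic form of a real `4 × 4` matrix. -/
def quadForm (V : Mat4) (p : Fin 2 ⊕ Fin 2 → ℝ) : ℝ := p ⬝ᵥ V *ᵥ p

lemma halfTrace_eq_quadForm (V : Mat4) (S T : Mat2) :
    halfTrace V S T
      = (quadForm V (Sum.elim (S 0) (T 0)) + quadForm V (Sum.elim (-S 1) (T 1))) / 2 := by
  simp only [halfTrace, bareNoise, quadForm, Z, Matrix.trace, Matrix.diag, Matrix.mul_apply,
    Fin.sum_univ_two, Fintype.sum_sum_type, dotProduct, mulVec, Matrix.add_apply, toBlocks₁₁,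
    toBlocks₁₂, toBlocks₂₁, toBlocks₂₂, of_apply, transpose_apply, cons_val', cons_val_zero,
    cons_val_one, Sum.elim_inl, Sum.elim_inr, Pi.neg_apply, cons_val_fin_one]
  ring

/-- The objective function that the optimal maps minimize. -/
noncomputable def cost (V : Mat4) (S T : Mat2) : ℝ :=
  |1 - S.det| + |1 - T.det| + halfTrace V S T

/-! ### Uncertainty and entanglement as inequalities between quadratic forms -/

/-- The uncertainty principle, in terms of real quadratic forms. -/
structure Uncertain (V : Mat4) : Prop where
  symm : Vᵀ = V
  le_halfTrace : ∀ S T : Mat2, T.det - S.det ≤ halfTrace V S T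

/-- Violation of the uncertainty principle by the partial transpose, in terms of real quadratic
forms. -/
def Inseparable (V : Mat4) : Prop := ∃ S T : Mat2, halfTrace V S T < S.det + T.det

lemma IsCM.uncertain {V : Mat4} (hV : IsCM V) : Uncertain V := by
  have hsymm : Vᵀ = V := by
    ext i j
    have h := congrFun (congrFun hV.isHermitian i) j
    have h' := congrArg Complex.re h
    simpa [toC, Matrix.conjTranspose_apply] using h'
  refine ⟨hsymm, fun S T => ?_⟩
  -- On `p + i q` with `p = (S₀, T₀)` and `q = (-S₁, T₁)` built from the rows, the symplectic form
  -- contributes `-2 (det T - det S)`.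
  have h := hV.dotProduct_mulVec_nonneg
    (Sum.elim (fun i => (S 0 i : ℂ) + Complex.I * (-S 1 i : ℝ))
      (fun i => (T 0 i : ℂ) + Complex.I * (T 1 i : ℝ)))
  have h' := (Complex.le_def.1 h).1
  rw [halfTrace_eq_quadForm]
  simp [dotProduct, mulVec, Fintype.sum_sum_type, Fin.sum_univ_two, toC, JJ, J] at h'
  simp [quadForm, dotProduct, mulVec, Fintype.sum_sum_type, Fin.sum_univ_two, det_fin_two]
  linarith

lemma quadForm_le (V : Mat4) (p : Fin 2 ⊕ Fin 2 → ℝ) :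
    quadForm V p ≤ (∑ i, ∑ j, |V i j|) * ∑ i, p i ^ 2 := by
  have : quadForm V p = ∑ i, ∑ j, V i j * (p i * p j) := by
    simp only [quadForm, dotProduct, mulVec, Finset.mul_sum]
    exact Finset.sum_congr rfl fun i _ => Finset.sum_congr rfl fun j _ => by ring
  rw [this, Finset.sum_mul]
  refine Finset.sum_le_sum fun i _ => ?_
  rw [Finset.sum_mul]
  refine Finset.sum_le_sum fun j _ => ?_
  have hij : |p i * p j| ≤ ∑ k, p k ^ 2 := by
    have h1 : p i ^ 2 ≤ ∑ k, p k ^ 2 :=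
      Finset.single_le_sum (f := fun k => p k ^ 2) (fun k _ => sq_nonneg _) (Finset.mem_univ i)
    have h2 : p j ^ 2 ≤ ∑ k, p k ^ 2 :=
      Finset.single_le_sum (f := fun k => p k ^ 2) (fun k _ => sq_nonneg _) (Finset.mem_univ j)
    rw [abs_le]
    constructor <;> nlinarith [sq_nonneg (p i + p j), sq_nonneg (p i - p j)]
  calc V i j * (p i * p j) ≤ |V i j * (p i * p j)| := le_abs_self _
    _ = |V i j| * |p i * p j| := abs_mul _ _
    _ ≤ _ := mul_le_mul_of_nonneg_left hij (abs_nonneg _)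

/-- A correlation matrix is bounded below by a positive multiple of the identity. -/
lemma Uncertain.exists_le_quadForm {V : Mat4} (hV : Uncertain V) :
    ∃ c : ℝ, 0 < c ∧ ∀ p, c * ∑ i, p i ^ 2 ≤ quadForm V p := by
  set K : ℝ := 1 + ∑ i, ∑ j, |V i j| with hK
  have hK0 : 0 < K := by positivity
  refine ⟨K⁻¹, inv_pos.2 hK0, fun p => ?_⟩
  set k := K⁻¹ with hk
  have hk0 : 0 < k := inv_pos.2 hK0
  have hkK : k * K = 1 := inv_mul_cancel₀ hK0.ne'
  -- `q` is `k` times `p` turned by a right angle in each mode. Uncertainty gives `2 k |p|² ≤ V(p) +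
  -- V(q)`, and `k = 1 / K` makes `V(q) ≤ k |p|²`.
  let q : Fin 2 ⊕ Fin 2 → ℝ := Sum.elim ![-p (.inl 1) * k, p (.inl 0) * k]
    ![-p (.inr 1) * k, p (.inr 0) * k]
  have h1 := hV.le_halfTrace (!![p (.inl 0), p (.inl 1); p (.inl 1) * k, -p (.inl 0) * k])
    (!![p (.inr 0), p (.inr 1); -p (.inr 1) * k, p (.inr 0) * k])
  rw [halfTrace_eq_quadForm] at h1
  have e1 : (Sum.elim (!![p (.inl 0), p (.inl 1); p (.inl 1) * k, -p (.inl 0) * k] 0)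
    (!![p (.inr 0), p (.inr 1); -p (.inr 1) * k, p (.inr 0) * k] 0)) = p := by
    ext (i | i) <;> fin_cases i <;> simp
  have e2 : (Sum.elim (-!![p (.inl 0), p (.inl 1); p (.inl 1) * k, -p (.inl 0) * k] 1)
    (!![p (.inr 0), p (.inr 1); -p (.inr 1) * k, p (.inr 0) * k] 1)) = q := by
    ext (i | i) <;> fin_cases i <;> simp [q]
  rw [e1, e2] at h1
  have h2 := quadForm_le V q
  have h3 : ∑ i, q i ^ 2 = k ^ 2 * ∑ i, p i ^ 2 := by
    simp [q, Fintype.sum_sum_type, Fin.sum_univ_two]; ring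
  have h4 : quadForm V q ≤ k * ∑ i, p i ^ 2 := by
    have h0 : (0:ℝ) ≤ ∑ i, p i ^ 2 := Finset.sum_nonneg fun i _ => sq_nonneg _
    calc quadForm V q ≤ (K - 1) * (k ^ 2 * ∑ i, p i ^ 2) := by
          rw [← h3]; simpa [hK] using h2
      _ ≤ K * (k ^ 2 * ∑ i, p i ^ 2) := by
          apply mul_le_mul_of_nonneg_right (by linarith); positivity
      _ = (k * K) * (k * ∑ i, p i ^ 2) := by ring
      _ = _ := by rw [hkK, one_mul]
  simp [det_fin_two] at h1
  simp only [Fintype.sum_sum_type, Fin.sum_univ_two] at h4 ⊢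
  nlinarith

lemma Uncertain.exists_le_halfTrace {V : Mat4} (hV : Uncertain V) :
    ∃ c : ℝ, 0 < c ∧ ∀ S T : Mat2,
      c * (∑ i, ∑ j, S i j ^ 2 + ∑ i, ∑ j, T i j ^ 2) ≤ halfTrace V S T := by
  obtain ⟨c, hc, h⟩ := hV.exists_le_quadForm
  refine ⟨c / 2, by positivity, fun S T => ?_⟩
  have h1 := h (Sum.elim (S 0) (T 0))
  have h2 := h (Sum.elim (-S 1) (T 1))
  rw [halfTrace_eq_quadForm]
  simp [Fintype.sum_sum_type, Fin.sum_univ_two] at h1 h2 ⊢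
  linarith

lemma Uncertain.halfTrace_nonneg {V : Mat4} (hV : Uncertain V) (S T : Mat2) :
    0 ≤ halfTrace V S T := by
  obtain ⟨c, hc, h⟩ := hV.exists_le_halfTrace
  exact le_trans (by positivity) (h S T)

lemma Uncertain.quadForm_nonneg {V : Mat4} (hV : Uncertain V) (p : Fin 2 ⊕ Fin 2 → ℝ) :
    0 ≤ quadForm V p := by
  obtain ⟨c, hc, h⟩ := hV.exists_le_quadForm
  exact le_trans (by positivity) (h p)

lemma Uncertain.quadForm_pos {V : Mat4} (hV : Uncertain V) {p : Fin 2 ⊕ Fin 2 → ℝ} (hp : p ≠ 0) :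
    0 < quadForm V p := by
  obtain ⟨c, hc, h⟩ := hV.exists_le_quadForm
  refine lt_of_lt_of_le ?_ (h p)
  obtain ⟨i, hi⟩ := Function.ne_iff.1 hp
  have : 0 < ∑ i, p i ^ 2 := Finset.sum_pos' (fun _ _ => sq_nonneg _)
    ⟨i, Finset.mem_univ i, by have : p i ≠ 0 := hi; positivity⟩
  positivity

/-- The real and imaginary parts of an eigenvector for `i ν`, with the partial transposition undone,
are vectors `p`, `q` whose quadratic forms sum to `2 ν (det S + det T)`. Positive definiteness makes
`det S + det T` positive, so `ν < 1` gives the strict inequality. -/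
lemma IsEntangled.inseparable {V : Mat4} (hV : Uncertain V) (hE : IsEntangled V) :
    Inseparable V := by
  obtain ⟨ν, ⟨h0, hdet⟩, h1⟩ := hE
  obtain ⟨w, hw, hw0⟩ := Matrix.exists_mulVec_eq_zero_iff.2 hdet
  set p : Fin 2 ⊕ Fin 2 → ℝ := Sum.elim ![(w (.inl 0)).re, -(w (.inl 1)).re]
    ![(w (.inr 0)).re, (w (.inr 1)).re] with hp
  set q : Fin 2 ⊕ Fin 2 → ℝ := Sum.elim ![(w (.inl 0)).im, -(w (.inl 1)).im]
    ![(w (.inr 0)).im, (w (.inr 1)).im] with hq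
  have heq : ∀ i, (((toC (JJ * partialTranspose V)
    - (Complex.I * (ν : ℂ)) • (1 : Matrix (Fin 2 ⊕ Fin 2) (Fin 2 ⊕ Fin 2) ℂ)) *ᵥ w) i) = 0 := by
    intro i; rw [hw0]; rfl
  refine ⟨!![p (.inl 0), p (.inl 1); -q (.inl 0), -q (.inl 1)],
    !![p (.inr 0), p (.inr 1); q (.inr 0), q (.inr 1)], ?_⟩
  rw [halfTrace_eq_quadForm]
  have e1 : (Sum.elim (!![p (.inl 0), p (.inl 1); -q (.inl 0), -q (.inl 1)] 0)
    (!![p (.inr 0), p (.inr 1); q (.inr 0), q (.inr 1)] 0)) = p := by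
    ext (i | i) <;> fin_cases i <;> simp
  have e2 : (Sum.elim (-!![p (.inl 0), p (.inl 1); -q (.inl 0), -q (.inl 1)] 1)
    (!![p (.inr 0), p (.inr 1); q (.inr 0), q (.inr 1)] 1)) = q := by
    ext (i | i) <;> fin_cases i <;> simp
  rw [e1, e2]
  have hpos : 0 < quadForm V p + quadForm V q := by
    have hpq : p ≠ 0 ∨ q ≠ 0 := by
      by_contra! hc
      apply hw
      have c1 := fun i => congrFun hc.1 i
      have c2 := fun i => congrFun hc.2 i
      have a1 := c1 (.inl 0); have a2 := c1 (.inl 1); have a3 := c1 (.inr 0)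
      have a4 := c1 (.inr 1); have b1 := c2 (.inl 0); have b2 := c2 (.inl 1)
      have b3 := c2 (.inr 0); have b4 := c2 (.inr 1)
      simp [hp, hq] at a1 a2 a3 a4 b1 b2 b3 b4
      ext (i | i) <;> fin_cases i <;> apply Complex.ext <;> simp [*]
    have n1 := hV.quadForm_nonneg p
    have n2 := hV.quadForm_nonneg q
    rcases hpq with h | h
    · linarith [hV.quadForm_pos h]
    · linarith [hV.quadForm_pos h]
  have key : quadForm V p + quadForm V q
      = 2 * ν * (-(p (.inl 0) * q (.inl 1) - p (.inl 1) * q (.inl 0))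
        + (p (.inr 0) * q (.inr 1) - p (.inr 1) * q (.inr 0))) := by
    have i1 := heq (.inl 0); have i2 := heq (.inl 1); have i3 := heq (.inr 0)
    have i4 := heq (.inr 1)
    simp [mulVec, dotProduct, Fintype.sum_sum_type, Fin.sum_univ_two, toC, JJ, J,
      partialTranspose, Matrix.mul_apply, Z, Matrix.one_apply] at i1 i2 i3 i4
    have r1 := congrArg Complex.re i1; have r2 := congrArg Complex.re i2
    have r3 := congrArg Complex.re i3; have r4 := congrArg Complex.re i4
    have m1 := congrArg Complex.im i1; have m2 := congrArg Complex.im i2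
    have m3 := congrArg Complex.im i3; have m4 := congrArg Complex.im i4
    simp at r1 r2 r3 r4 m1 m2 m3 m4
    simp [quadForm, dotProduct, mulVec, Fintype.sum_sum_type, Fin.sum_univ_two, hp, hq]
    linear_combination (-(w (.inl 0)).re) * r2 + (w (.inl 1)).re * r1
      - (w (.inr 0)).re * r4 + (w (.inr 1)).re * r3
      - (w (.inl 0)).im * m2 + (w (.inl 1)).im * m1
      - (w (.inr 0)).im * m4 + (w (.inr 1)).im * m3
  simp only [det_fin_two_of]
  set ρ := (-(p (.inl 0) * q (.inl 1) - p (.inl 1) * q (.inl 0))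
        + (p (.inr 0) * q (.inr 1) - p (.inr 1) * q (.inr 0))) with hρ
  have hρ0 : 0 < ρ := by
    by_contra! hc
    nlinarith [mul_nonneg h0 (neg_nonneg.2 hc)]
  nlinarith [hρ0, key, h1]

/-! ### Determinant inequalities for `2 × 2` matrices -/

/-- `N` is a positive semidefinite real `2 × 2` matrix with `det N ≥ g²`. -/
structure DetBound (N : Mat2) (g : ℝ) : Prop where
  symm : N 1 0 = N 0 1
  nonneg₀ : 0 ≤ N 0 0
  nonneg₁ : 0 ≤ N 1 1
  nonneg : 0 ≤ g
  le : N 0 1 ^ 2 + g ^ 2 ≤ N 0 0 * N 1 1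

namespace DetBound

/-- The Minkowski inequality for determinants of `2 × 2` matrices. -/
lemma add {N N' : Mat2} {g g' : ℝ} (h : DetBound N g) (h' : DetBound N' g') :
    DetBound (N + N') (g + g') where
  symm := by simp [h.symm, h'.symm]
  nonneg₀ := add_nonneg h.nonneg₀ h'.nonneg₀
  nonneg₁ := add_nonneg h.nonneg₁ h'.nonneg₁
  nonneg := add_nonneg h.nonneg h'.nonneg
  le := by
    have h1 := h.le
    have h2 := h'.le
    simp only [Matrix.add_apply]
    set a := N 0 0; set b := N 0 1; set c := N 1 1
    set a' := N' 0 0; set b' := N' 0 1; set c' := N' 1 1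
    have ha := h.nonneg₀; have hc := h.nonneg₁; have ha' := h'.nonneg₀; have hc' := h'.nonneg₁
    -- Cauchy-Schwarz for `(b, g)` and `(b', g')`, then AM-GM for `a c'` and `a' c`.
    have key : 2 * (b * b' + g * g') ≤ a * c' + a' * c := by
      apply le_of_sq_le_sq _ (by positivity)
      have e1 : (b * b' + g * g') ^ 2 ≤ (b ^ 2 + g ^ 2) * (b' ^ 2 + g' ^ 2) := by
        nlinarith [sq_nonneg (b * g' - b' * g)]
      have e2 : (b ^ 2 + g ^ 2) * (b' ^ 2 + g' ^ 2) ≤ (a * c) * (a' * c') :=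
        mul_le_mul h1 h2 (by positivity) (by positivity)
      nlinarith [sq_nonneg (a * c' - a' * c)]
    nlinarith

lemma two_mul_le_trace {N : Mat2} {g : ℝ} (h : DetBound N g) : 2 * g ≤ N.trace := by
  rw [trace_fin_two]
  apply le_of_sq_le_sq _ (add_nonneg h.nonneg₀ h.nonneg₁)
  nlinarith [h.le, sq_nonneg (N 0 0 - N 1 1), sq_nonneg (N 0 1)]

lemma eq_smul_one {N : Mat2} {g : ℝ} (h : DetBound N g) (ht : N.trace ≤ 2 * g) :
    N = g • (1 : Mat2) := by
  rw [trace_fin_two] at ht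
  have h1 := h.le
  have h2 := h.nonneg₀; have h3 := h.nonneg₁; have h4 := h.nonneg
  have h5 : (N 0 0 - N 1 1) ^ 2 + (2 * N 0 1) ^ 2 ≤ 0 := by nlinarith
  have h6 : N 0 1 = 0 := by nlinarith [sq_nonneg (N 0 0 - N 1 1), sq_nonneg (N 0 1)]
  have h7 : N 0 0 = N 1 1 := by
    have : (N 0 0 - N 1 1) ^ 2 = 0 := le_antisymm (by nlinarith) (sq_nonneg _)
    nlinarith [pow_eq_zero_iff (two_ne_zero) |>.1 this]
  have h8 : N 0 0 = g := by
    rw [h6, ← h7] at h1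
    nlinarith
  ext i j
  fin_cases i <;> fin_cases j <;> simp [h.symm, h6, h8, ← h7]

lemma sq_le_det {N : Mat2} {g : ℝ} (h : DetBound N g) :
    (2 + g) ^ 2 ≤ ((2 : ℝ) • (1 : Mat2) + N).det := by
  have h1 := h.two_mul_le_trace
  rw [trace_fin_two] at h1
  simp [det_fin_two, h.symm]
  nlinarith [h.le]

lemma trace_le {N : Mat2} {g : ℝ} (h : DetBound N g)
    (hd : ((2 : ℝ) • (1 : Mat2) + N).det ≤ (2 + g) ^ 2) : N.trace ≤ 2 * g := by
  rw [trace_fin_two]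
  simp [det_fin_two, h.symm] at hd
  nlinarith [h.le]

end DetBound

lemma det_le_sq_of_trace {N : Mat2} (h : N 1 0 = N 0 1) :
    ((2 : ℝ) • (1 : Mat2) + N).det ≤ (2 + N.trace / 2) ^ 2 := by
  simp [det_fin_two, trace_fin_two, h]
  nlinarith [sq_nonneg (N 0 0 - N 1 1), sq_nonneg (N 0 1)]

/-- A positive definite `2 × 2` matrix becomes scalar under congruence with a suitable matrix of
determinant one. -/
lemma exists_det_one_congr {N : Mat2} (hs : N 1 0 = N 0 1) (h0 : 0 < N 0 0) (hd : 0 < N.det) :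
    ∃ R : Mat2, R.det = 1 ∧ R * N * Rᵀ = √N.det • (1 : Mat2) := by
  set q := √N.det with hq
  have hq0 : 0 < q := Real.sqrt_pos.2 hd
  have hqq : q ^ 2 = N 0 0 * N 1 1 - N 0 1 ^ 2 := by
    rw [hq, Real.sq_sqrt hd.le, det_fin_two, hs]; ring
  set x := √(q / N 0 0) with hx
  have hx0 : 0 < x := Real.sqrt_pos.2 (by positivity)
  have hxx : x ^ 2 * N 0 0 = q := by
    rw [hx, Real.sq_sqrt (by positivity)]; field_simp
  -- A Cholesky factor: `x` scales the first diagonal entry to `q`, the second row removes the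
  -- off-diagonal entry, and determinant one leaves `q` as the last entry.
  refine ⟨!![x, 0; -N 0 1 / (N 0 0 * x), x⁻¹], by simp [hx0.ne'], ?_⟩
  have hN := h0.ne'
  ext i j
  fin_cases i <;> fin_cases j <;>
    simp [Matrix.mul_apply, Fin.sum_univ_two, vecMul, dotProduct, hs]
  · linear_combination hxx
  · field_simp; ring
  · left; field_simp; ring
  · field_simp
    linear_combination -hqq - q * hxx

/-! ### Reduction of the fidelity to the cost -/

/-- Since `S J Sᵀ = det S • J`, complete positivity says `G + i (1 - det S) J ≥ 0`, a matrix of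
determinant `det G - (1 - det S)²`. -/
lemma TGCP.detBound (ω : TGCP) : DetBound ω.G |1 - ω.S.det| := by
  have h := ω.cp
  rw [mul_J_mul_transpose] at h
  have hsymm := congrArg Complex.re (congrFun (congrFun h.isHermitian 0) 1)
  have h0 := (Complex.le_def.1 (h.diag_nonneg (i := 0))).1
  have h1 := (Complex.le_def.1 (h.diag_nonneg (i := 1))).1
  have hd := (Complex.le_def.1 h.det_nonneg).1
  simp [toC, J, Matrix.conjTranspose_apply, det_fin_two] at hsymm h0 h1 hd
  refine ⟨hsymm, h0, h1, abs_nonneg _, ?_⟩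
  rw [sq_abs]
  simp only [det_fin_two]
  rw [hsymm] at hd
  nlinarith

lemma DetBound.Z_congr {N : Mat2} {g : ℝ} (h : DetBound N g) : DetBound (Z * N * Z) g := by
  have := h.symm; have := h.nonneg₀; have := h.nonneg₁; have := h.nonneg; have := h.le
  constructor <;> simp [Z, Matrix.mul_apply, Fin.sum_univ_two, vecMul, dotProduct, *]

/-- The map with given `S` and the least isotropic noise. -/
noncomputable def TGCP.isotropic (S : Mat2) : TGCP where
  S := S
  G := |1 - S.det| • 1
  cp := by
    rw [mul_J_mul_transpose]
    have hJ := one_add_J_posSemidef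
    have hJ' : ((1 : Matrix (Fin 2) (Fin 2) ℂ) - Complex.I • toC J).PosSemidef := by
      have h := Matrix.posSemidef_self_mul_conjTranspose
        (!![1, 0; Complex.I, 0] : Matrix (Fin 2) (Fin 2) ℂ)
      convert h using 1
      ext i j
      fin_cases i <;> fin_cases j <;> simp [toC, J, Matrix.mul_apply, Matrix.conjTranspose_apply]
    have hg : (0 : ℂ) ≤ ((|1 - S.det| : ℝ) : ℂ) := by exact_mod_cast abs_nonneg (1 - S.det)
    rcases le_total 0 (1 - S.det) with h | h
    · rw [abs_of_nonneg h] at hg ⊢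
      convert hJ.smul hg using 1
      ext i j
      fin_cases i <;> fin_cases j <;> simp [toC, J] <;> ring
    · rw [abs_of_nonpos h] at hg ⊢
      convert hJ'.smul hg using 1
      ext i j
      fin_cases i <;> fin_cases j <;> simp [toC, J] <;> ring

/-- The local map with given `S ⊕ T` and the least isotropic noise. -/
noncomputable def LocalTGCP.isotropic (S T : Mat2) : LocalTGCP :=
  ⟨TGCP.isotropic S, TGCP.isotropic T⟩

lemma bareNoise_symm {V : Mat4} (hV : Uncertain V) (S T : Mat2) :
    (bareNoise V S T)ᵀ = bareNoise V S T := by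
  have h11 : V.toBlocks₁₁ᵀ = V.toBlocks₁₁ := by
    ext i j; exact congrFun (congrFun hV.symm (.inl i)) (.inl j)
  have h12 : V.toBlocks₁₂ᵀ = V.toBlocks₂₁ := by
    ext i j; exact congrFun (congrFun hV.symm (.inr i)) (.inl j)
  have h21 : V.toBlocks₂₁ᵀ = V.toBlocks₁₂ := by
    ext i j; exact congrFun (congrFun hV.symm (.inl i)) (.inr j)
  have h22 : V.toBlocks₂₂ᵀ = V.toBlocks₂₂ := by
    ext i j; exact congrFun (congrFun hV.symm (.inr i)) (.inr j)
  simp only [bareNoise, transpose_add, transpose_mul, transpose_transpose, h11, h12, h21, h22,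
    Z_transpose, Matrix.mul_assoc]
  abel

/-- The bare noise is `M V Mᵀ` with `M = (Z S, T)`. Hence it is positive semidefinite, and a null
vector is a linear relation between the rows of `M`. -/
lemma bareNoise_quad {V : Mat4} (hV : Uncertain V) (S T : Mat2) (x y : ℝ) :
    bareNoise V S T 0 0 * x ^ 2 + 2 * bareNoise V S T 0 1 * x * y + bareNoise V S T 1 1 * y ^ 2
      = quadForm V (Sum.elim (x • S 0 - y • S 1) (x • T 0 + y • T 1)) := by
  have e : ∀ i j, V i j = V j i := fun i j => congrFun (congrFun hV.symm j) i
  simp only [bareNoise, quadForm, Z, Matrix.mul_apply,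
    Fin.sum_univ_two, Fintype.sum_sum_type, dotProduct, mulVec, Matrix.add_apply, toBlocks₁₁,
    toBlocks₁₂, toBlocks₂₁, toBlocks₂₂, of_apply, transpose_apply, cons_val', cons_val_zero,
    cons_val_one, Sum.elim_inl, Sum.elim_inr, Pi.sub_apply, Pi.add_apply, Pi.smul_apply,
    smul_eq_mul, cons_val_fin_one, e (.inl 1) (.inl 0), e (.inr 1) (.inr 0),
    e (.inr 0) (.inl 0), e (.inr 0) (.inl 1), e (.inr 1) (.inl 0), e (.inr 1) (.inl 1)]
  ring

lemma bareNoise_detBound {V : Mat4} (hV : Uncertain V) (S T : Mat2) :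
    DetBound (bareNoise V S T) √(bareNoise V S T).det := by
  have hs : bareNoise V S T 1 0 = bareNoise V S T 0 1 :=
    congrFun (congrFun (bareNoise_symm hV S T) 0) 1
  have hq : ∀ x y : ℝ, 0 ≤ bareNoise V S T 0 0 * x ^ 2 + 2 * bareNoise V S T 0 1 * x * y
      + bareNoise V S T 1 1 * y ^ 2 := fun x y => by
    rw [bareNoise_quad hV]; exact hV.quadForm_nonneg _
  have h0 : 0 ≤ bareNoise V S T 0 0 := by simpa using hq 1 0
  have h1 : 0 ≤ bareNoise V S T 1 1 := by simpa using hq 0 1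
  have hd : 0 ≤ (bareNoise V S T).det := by
    rw [det_fin_two, hs]
    set a := bareNoise V S T 0 0; set b := bareNoise V S T 0 1; set c := bareNoise V S T 1 1
    -- At `(b, -a)` the form equals `a (a c - b²)`. If `a = 0`, its value `-(c + 2) b²` at `(-(c +
    -- 1), b)` forces `b = 0`.
    have e1 := hq b (-a)
    rcases h0.eq_or_lt with h | h
    · have := hq (-(c + 1)) b
      rw [← h] at this ⊢
      nlinarith [sq_nonneg b]
    · by_contra! hc
      nlinarith
  refine ⟨hs, h0, h1, Real.sqrt_nonneg _, ?_⟩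
  rw [Real.sq_sqrt hd, det_fin_two, hs]
  nlinarith

/-- A transformation with the same determinants whose half trace is the square root of the
determinant of the bare noise. -/
lemma exists_halfTrace_eq_sqrt_det {V : Mat4} (hV : Uncertain V) (S T : Mat2) :
    ∃ S' T' : Mat2, S'.det = S.det ∧ T'.det = T.det ∧
      halfTrace V S' T' = √(bareNoise V S T).det := by
  have hB := bareNoise_detBound hV S T
  rcases le_or_gt (bareNoise V S T).det 0 with hd | hd
  -- If the bare noise is singular, a null vector gives a relation between the rows that makes `S`
  -- and `T` both singular, and the pair `(0, 0)` serves.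
  · have hzero : ∃ x y : ℝ, (x, y) ≠ 0 ∧ bareNoise V S T 0 0 * x ^ 2
        + 2 * bareNoise V S T 0 1 * x * y + bareNoise V S T 1 1 * y ^ 2 = 0 := by
      have h0 := hB.nonneg₀
      have hle := hB.le
      have hdet := hd
      rw [Real.sqrt_eq_zero_of_nonpos hd] at hle
      rw [det_fin_two, hB.symm] at hdet
      rcases eq_or_ne (bareNoise V S T 0 0) 0 with h | h
      · exact ⟨1, 0, by simp, by simp [h]⟩
      · refine ⟨bareNoise V S T 0 1, -bareNoise V S T 0 0, by simp [h], ?_⟩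
        nlinarith
    obtain ⟨x, y, hxy, he⟩ := hzero
    rw [bareNoise_quad hV] at he
    have hz : Sum.elim (x • S 0 - y • S 1) (x • T 0 + y • T 1) = 0 := by
      by_contra hc
      exact (hV.quadForm_pos hc).ne' he
    have a1 := congrFun hz (.inl 0); have a2 := congrFun hz (.inl 1)
    have b1 := congrFun hz (.inr 0); have b2 := congrFun hz (.inr 1)
    simp at a1 a2 b1 b2
    have hSd : x * S.det = 0 ∧ y * S.det = 0 := by
      rw [det_fin_two]
      exact ⟨by linear_combination S 1 1 * a1 - S 1 0 * a2,
        by linear_combination S 0 1 * a1 - S 0 0 * a2⟩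
    have hTd : x * T.det = 0 ∧ y * T.det = 0 := by
      rw [det_fin_two]
      exact ⟨by linear_combination T 1 1 * b1 - T 1 0 * b2,
        by linear_combination -T 0 1 * b1 + T 0 0 * b2⟩
    have hS0 : S.det = 0 := by
      by_contra hc
      exact hxy (by simp [(mul_eq_zero.1 hSd.1).resolve_right hc,
        (mul_eq_zero.1 hSd.2).resolve_right hc])
    have hT0 : T.det = 0 := by
      by_contra hc
      exact hxy (by simp [(mul_eq_zero.1 hTd.1).resolve_right hc,
        (mul_eq_zero.1 hTd.2).resolve_right hc])
    refine ⟨0, 0, by simp [hS0], by simp [hT0], ?_⟩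
    rw [Real.sqrt_eq_zero_of_nonpos hd]
    simp [halfTrace, bareNoise]
  · have h0 : 0 < bareNoise V S T 0 0 := by
      refine hB.nonneg₀.lt_of_ne fun h => ?_
      rw [det_fin_two, ← h, hB.symm] at hd
      nlinarith [sq_nonneg (bareNoise V S T 0 1)]
    obtain ⟨R, hR, hN⟩ := exists_det_one_congr hB.symm h0 hd
    refine ⟨Z * R * Z * S, R * T, ?_, ?_, ?_⟩
    · have hZ : Z.det * Z.det = 1 := by rw [← det_mul, Z_mul_Z, det_one]
      simp only [det_mul, hR]
      linear_combination S.det * hZ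
    · simp [hR]
    · rw [halfTrace, bareNoise_mul_left, hN]
      simp

lemma fidelity_apply (ω : LocalTGCP) (V : Mat4) :
    fidelity (ω.apply V) = 2 / √((2 : ℝ) • (1 : Mat2)
      + (bareNoise V ω.alice.S ω.bob.S + Z * ω.alice.G * Z + ω.bob.G)).det := by
  rw [fidelity, gaussianFidelity, noise_apply]

lemma LocalTGCP.noise_detBound {V : Mat4} (hV : Uncertain V) (ω : LocalTGCP) :
    DetBound (bareNoise V ω.alice.S ω.bob.S + Z * ω.alice.G * Z + ω.bob.G)
      (√(bareNoise V ω.alice.S ω.bob.S).det + |1 - ω.alice.S.det| + |1 - ω.bob.S.det|) :=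
  ((bareNoise_detBound hV _ _).add ω.alice.detBound.Z_congr).add ω.bob.detBound

lemma cost_nonneg {V : Mat4} (hV : Uncertain V) (S T : Mat2) : 0 ≤ cost V S T := by
  have := hV.halfTrace_nonneg S T
  unfold cost; positivity

lemma le_fidelity_isotropic {V : Mat4} (hV : Uncertain V) (S T : Mat2) :
    2 / (2 + cost V S T) ≤ fidelity ((LocalTGCP.isotropic S T).apply V) := by
  rw [fidelity_apply]
  have hB := LocalTGCP.noise_detBound hV (LocalTGCP.isotropic S T)
  have h1 := hB.sq_le_det
  have h2 := det_le_sq_of_trace hB.symm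
  have hc := cost_nonneg hV S T
  have ht : (bareNoise V S T + Z * (|1 - S.det| • (1 : Mat2)) * Z
      + |1 - T.det| • (1 : Mat2)).trace / 2 = cost V S T := by
    rw [Matrix.mul_smul, Matrix.mul_one, Matrix.smul_mul, Z_mul_Z]
    simp [cost, halfTrace]; ring
  simp only [LocalTGCP.isotropic, TGCP.isotropic] at h1 h2 ⊢
  rw [ht] at h2
  apply div_le_div_of_nonneg_left zero_le_two
  · exact Real.sqrt_pos.2 (lt_of_lt_of_le (by positivity) h1)
  · exact Real.sqrt_le_iff.2 ⟨by positivity, h2⟩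

/-- The canonical noise: the least noise for the given determinants, isotropic in total. -/
structure HasLeastNoise (V : Mat4) (ω : LocalTGCP) : Prop where
  alice : ω.alice.G = |1 - ω.alice.S.det| • (1 : Mat2)
  bob : ω.bob.G = |1 - ω.bob.S.det| • (1 : Mat2)
  bare : bareNoise V ω.alice.S ω.bob.S = halfTrace V ω.alice.S ω.bob.S • (1 : Mat2)

lemma fidelity_of_hasLeastNoise {V : Mat4} (hV : Uncertain V) {ω : LocalTGCP}
    (h : HasLeastNoise V ω) :
    fidelity (ω.apply V) = 2 / (2 + cost V ω.alice.S ω.bob.S) := by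
  have hc := cost_nonneg hV ω.alice.S ω.bob.S
  rw [fidelity_apply, h.alice, h.bob, h.bare, Matrix.mul_smul, Matrix.mul_one, Matrix.smul_mul, Z_mul_Z,
    ← add_smul, ← add_smul, ← add_smul, det_smul]
  have e : 2 + halfTrace V ω.alice.S ω.bob.S + |1 - ω.alice.S.det| + |1 - ω.bob.S.det|
    = 2 + cost V ω.alice.S ω.bob.S := by unfold cost; ring
  simp only [← add_assoc, e, Fintype.card_fin, det_one, mul_one]
  rw [Real.sqrt_sq (by positivity)]

/-- The fidelity is bounded by the cost of a suitable transformation. -/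
lemma exists_fidelity_le {V : Mat4} (hV : Uncertain V) (ω : LocalTGCP) :
    ∃ S T : Mat2, fidelity (ω.apply V) ≤ 2 / (2 + cost V S T) ∧
      (2 / (2 + cost V S T) ≤ fidelity (ω.apply V) → HasLeastNoise V ω ∧
        cost V S T = cost V ω.alice.S ω.bob.S) := by
  obtain ⟨S, T, hS, hT, hq⟩ := exists_halfTrace_eq_sqrt_det hV ω.alice.S ω.bob.S
  have hB := LocalTGCP.noise_detBound hV ω
  have hc : cost V S T = √(bareNoise V ω.alice.S ω.bob.S).det + |1 - ω.alice.S.det|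
      + |1 - ω.bob.S.det| := by
    rw [cost, hS, hT, hq]; ring
  have h0 := cost_nonneg hV S T
  have h1 := hB.sq_le_det
  rw [← hc] at h1
  have h2 : 2 + cost V S T ≤ √((2 : ℝ) • (1 : Mat2)
      + (bareNoise V ω.alice.S ω.bob.S + Z * ω.alice.G * Z + ω.bob.G)).det :=
    Real.le_sqrt_of_sq_le h1
  refine ⟨S, T, ?_, fun h => ?_⟩
  · rw [fidelity_apply]
    exact div_le_div_of_nonneg_left zero_le_two (by positivity) h2
  · rw [fidelity_apply, div_le_div_iff_of_pos_left two_pos (by positivity)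
      (lt_of_lt_of_le (by positivity) h2)] at h
    have h3 := (Real.sqrt_le_iff.1 h).2
    rw [hc] at h3
    have h4 := hB.trace_le h3
    have b1 := bareNoise_detBound hV ω.alice.S ω.bob.S
    have b2 := ω.alice.detBound
    have b3 := ω.bob.detBound
    have t2 : (Z * ω.alice.G * Z).trace = ω.alice.G.trace := by
      rw [trace_mul_comm, ← Matrix.mul_assoc, Z_mul_Z, Matrix.one_mul]
    rw [trace_add, trace_add, t2] at h4
    -- The trace of each of the three summands is at least twice its bound, and their sum is at most
    -- twice the sum of the bounds. So each is tight, hence scalar.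
    have c1 := b1.two_mul_le_trace
    have c2 := b2.two_mul_le_trace
    have c3 := b3.two_mul_le_trace
    have d1 := b1.eq_smul_one (by linarith)
    have hh : halfTrace V ω.alice.S ω.bob.S = √(bareNoise V ω.alice.S ω.bob.S).det := by
      rw [halfTrace]; linarith
    refine ⟨⟨b2.eq_smul_one (by linarith), b3.eq_smul_one (by linarith), ?_⟩, ?_⟩
    · rw [hh]; exact d1
    · rw [hc, cost, hh]; ring

lemma isOptimal_iff {V : Mat4} (hV : Uncertain V) (ω : LocalTGCP) :
    IsOptimal V ω ↔ HasLeastNoise V ω ∧ ∀ S T, cost V ω.alice.S ω.bob.S ≤ cost V S T := by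
  constructor
  · intro h
    obtain ⟨S, T, h1, h2⟩ := exists_fidelity_le hV ω
    obtain ⟨h3, h4⟩ := h2 ((le_fidelity_isotropic hV S T).trans (h _))
    refine ⟨h3, fun S' T' => ?_⟩
    have h5 := (le_fidelity_isotropic hV S' T').trans (h _)
    rw [fidelity_of_hasLeastNoise hV h3] at h5
    have p1 := cost_nonneg hV ω.alice.S ω.bob.S
    have p2 := cost_nonneg hV S' T'
    rw [div_le_div_iff_of_pos_left two_pos (by positivity) (by positivity)] at h5
    linarith
  · rintro ⟨h1, h2⟩ ω'
    obtain ⟨S, T, h3, -⟩ := exists_fidelity_le hV ω'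
    refine h3.trans ?_
    rw [fidelity_of_hasLeastNoise hV h1]
    have p1 := cost_nonneg hV ω.alice.S ω.bob.S
    exact div_le_div_of_nonneg_left zero_le_two (by positivity) (by linarith [h2 S T])

/-! ### Existence of an optimal map by compactness -/

lemma cost_continuous (V : Mat4) : Continuous fun x : Mat2 × Mat2 => cost V x.1 x.2 := by
  unfold cost halfTrace bareNoise
  fun_prop

lemma isCompact_setOf_entry_mem_Icc (r : ℝ) :
    IsCompact {S : Mat2 | ∀ i j, S i j ∈ Set.Icc (-r) r} := by
  have h : IsCompact (Set.pi Set.univ fun _ : Fin 2 => Set.pi Set.univ fun _ : Fin 2 =>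
      Set.Icc (-r) r) := isCompact_univ_pi fun _ => isCompact_univ_pi fun _ => isCompact_Icc
  have e : {S : Mat2 | ∀ i j, S i j ∈ Set.Icc (-r) r} = (Set.pi Set.univ fun _ : Fin 2 =>
      Set.pi Set.univ fun _ : Fin 2 => Set.Icc (-r) r : Set (Fin 2 → Fin 2 → ℝ)) :=
    Set.ext fun S => ⟨fun h i _ j _ => h i j, fun h i j => h i trivial j trivial⟩
  rw [e]
  exact h

lemma exists_forall_le_of_sublevel_bounded {f : Mat2 × Mat2 → ℝ} (hf : Continuous f) {r : ℝ}
    (h : ∀ x, f x ≤ f 0 →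
      (∀ i j, x.1 i j ∈ Set.Icc (-r) r) ∧ ∀ i j, x.2 i j ∈ Set.Icc (-r) r) :
    ∃ x, ∀ y, f x ≤ f y := by
  have hK := (isCompact_setOf_entry_mem_Icc r).prod (isCompact_setOf_entry_mem_Icc r)
  have h0 := h 0 le_rfl
  obtain ⟨x, hx, hm⟩ := hK.exists_isMinOn ⟨0, h0⟩ hf.continuousOn
  have hm := isMinOn_iff.1 hm
  refine ⟨x, fun y => ?_⟩
  rcases le_total (f y) (f 0) with hy | hy
  · exact hm y (h y hy)
  · exact (hm 0 h0).trans hy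

/-- The half trace is coercive, so the pairs of cost at most `cost V 0 0 = 2` have bounded entries.
-/
lemma exists_forall_cost_le {V : Mat4} (hV : Uncertain V) :
    ∃ S T : Mat2, ∀ S' T', cost V S T ≤ cost V S' T' := by
  obtain ⟨c, hc, h⟩ := hV.exists_le_halfTrace
  have hf := cost_continuous V
  have h0 : cost V 0 0 = 2 := by
    simp [cost, halfTrace, bareNoise]; norm_num
  have hb : ∀ S T : Mat2, cost V S T ≤ cost V 0 0 →
      (∀ i j, S i j ∈ Set.Icc (-√(2 / c)) √(2 / c)) ∧
        ∀ i j, T i j ∈ Set.Icc (-√(2 / c)) √(2 / c) := by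
    intro S T hST
    rw [h0] at hST
    have h2 := h S T
    have h3 : halfTrace V S T ≤ 2 := by
      have a1 := abs_nonneg (1 - S.det)
      have a2 := abs_nonneg (1 - T.det)
      unfold cost at hST; linarith
    have hb : ∀ x : ℝ, x ^ 2 ≤ ∑ i, ∑ j, S i j ^ 2 + ∑ i, ∑ j, T i j ^ 2 →
        x ∈ Set.Icc (-√(2 / c)) √(2 / c) := by
      intro x hx
      apply abs_le.1
      apply Real.abs_le_sqrt
      rw [le_div_iff₀ hc]
      nlinarith
    have hle : ∀ (M : Mat2) (i j : Fin 2), M i j ^ 2 ≤ ∑ i, ∑ j, M i j ^ 2 := fun M i j =>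
      (Finset.single_le_sum (f := fun j => M i j ^ 2) (fun _ _ => sq_nonneg _)
        (Finset.mem_univ j)).trans
      (Finset.single_le_sum (f := fun i => ∑ j, M i j ^ 2)
        (fun _ _ => by positivity) (Finset.mem_univ i))
    have hS0 : 0 ≤ ∑ i, ∑ j, S i j ^ 2 := by positivity
    have hT0 : 0 ≤ ∑ i, ∑ j, T i j ^ 2 := by positivity
    exact ⟨fun i j => hb _ (by linarith [hle S i j]), fun i j => hb _ (by linarith [hle T i j])⟩
  obtain ⟨x, hx⟩ := exists_forall_le_of_sublevel_bounded hf
    fun x hx => hb x.1 x.2 hx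
  exact ⟨x.1, x.2, fun S' T' => hx (S', T')⟩

lemma exists_isOptimal {V : Mat4} (hV : Uncertain V) : ∃ ω : LocalTGCP, IsOptimal V ω := by
  obtain ⟨S, T, hmin⟩ := exists_forall_cost_le hV
  refine ⟨LocalTGCP.isotropic S T, fun ω' => ?_⟩
  obtain ⟨S', T', h3, -⟩ := exists_fidelity_le hV ω'
  refine h3.trans (le_trans ?_ (le_fidelity_isotropic hV S T))
  have p1 := cost_nonneg hV S T
  exact div_le_div_of_nonneg_left zero_le_two (by positivity) (by linarith [hmin S' T'])

/-! ### Determinants at a minimum of the cost -/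

lemma halfTrace_smul (V : Mat4) (r : ℝ) (S T : Mat2) :
    halfTrace V (r • S) (r • T) = r ^ 2 * halfTrace V S T := by
  have : bareNoise V (r • S) (r • T) = r ^ 2 • bareNoise V S T := by
    simp only [bareNoise, transpose_smul, Matrix.mul_smul, Matrix.smul_mul, smul_add, smul_smul, sq]
  rw [halfTrace, this, trace_smul, smul_eq_mul, halfTrace]; ring

lemma halfTrace_mul_left_of_orthogonal (V : Mat4) {R : Mat2} (hR : Rᵀ * R = 1) (S T : Mat2) :
    halfTrace V (Z * R * Z * S) (R * T) = halfTrace V S T := by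
  rw [halfTrace, bareNoise_mul_left, trace_mul_comm, ← Matrix.mul_assoc, hR, Matrix.one_mul,
    halfTrace]

lemma det_Z : Z.det = -1 := by simp [Z]

/-- Multiplying `S` and `T` by the reflection `Z` flips both determinants and keeps the half trace.
-/
lemma Uncertain.abs_sub_le {V : Mat4} (hV : Uncertain V) (S T : Mat2) :
    |T.det - S.det| ≤ halfTrace V S T := by
  rw [abs_le]
  refine ⟨?_, hV.le_halfTrace S T⟩
  have h := hV.le_halfTrace (Z * Z * Z * S) (Z * T)
  rw [halfTrace_mul_left_of_orthogonal V (by rw [Z_transpose, Z_mul_Z])] at h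
  simp only [det_mul, det_Z] at h
  linarith

lemma Inseparable.exists_cost_lt_two {V : Mat4} (hI : Inseparable V) :
    ∃ S T : Mat2, cost V S T < 2 := by
  obtain ⟨S, T, h⟩ := hI
  -- Small enough that both scaled determinants stay at most `1`, where the cost is `2 - k (det S +
  -- det T - halfTrace V S T)`.
  set k : ℝ := 1 / (1 + |S.det| + |T.det|) with hk
  have hk0 : 0 < k := by positivity
  have hS : k * S.det ≤ 1 := by
    rw [hk, one_div, inv_mul_le_iff₀ (by positivity)]
    linarith [le_abs_self S.det, abs_nonneg T.det]
  have hT : k * T.det ≤ 1 := by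
    rw [hk, one_div, inv_mul_le_iff₀ (by positivity)]
    linarith [le_abs_self T.det, abs_nonneg S.det]
  refine ⟨√k • S, √k • T, ?_⟩
  rw [cost, halfTrace_smul, det_smul, det_smul, Fintype.card_fin, Real.sq_sqrt hk0.le,
    abs_of_nonneg (by linarith), abs_of_nonneg (by linarith)]
  nlinarith

/-- Where the cost is minimal along a ray. -/
lemma eq_one_of_minimal_on_ray {a b t : ℝ}
    (hk : ∀ k : ℝ, 0 ≤ k → |1 - a| + |1 - b| + t ≤ |1 - k * a| + |1 - k * b| + k * t)
    (ht : |b - a| ≤ t) (h2 : |1 - a| + |1 - b| + t < 2) :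
    (a = 1 ∧ 0 < b ∧ b ≤ 1) ∨ (b = 1 ∧ 0 < a ∧ a ≤ 1) := by
  wlog hab : b ≤ a generalizing a b
  · rcases this (a := b) (b := a) (fun k hk0 => by have := hk k hk0; linarith)
      (by rwa [abs_sub_comm]) (by linarith) (le_of_not_ge hab) with h | h
    · exact Or.inr h
    · exact Or.inl h
  have ht0 : a - b ≤ t := by rw [abs_sub_comm] at ht; exact (le_abs_self _).trans ht
  -- Compare with `k = a⁻¹`, which brings the larger determinant to `1`. If `a < 1`, the cost along
  -- the ray is `2 - k (a + b - t)`, strictly decreasing up to `a⁻¹`; if `a > 1`, it is strictly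
  -- smaller at `a⁻¹` than at `1`.
  have ha1 : a = 1 := by
    rcases lt_trichotomy a 1 with h | h | h
    · exfalso
      rw [abs_of_pos (by linarith), abs_of_pos (by linarith)] at h2
      have ha0 : 0 < a := by linarith
      have h1 := hk a⁻¹ (by positivity)
      have e : a⁻¹ * a = 1 := inv_mul_cancel₀ ha0.ne'
      have e1 : 1 < a⁻¹ := (one_lt_inv₀ ha0).2 h
      have e2 : a⁻¹ * b ≤ 1 := by rw [← e]; exact mul_le_mul_of_nonneg_left hab (by positivity)
      rw [e, sub_self, abs_zero, abs_of_pos (by linarith), abs_of_pos (by linarith),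
        abs_of_nonneg (by linarith)] at h1
      nlinarith
    · exact h
    · exfalso
      have ha0 : 0 < a := by linarith
      have h1 := hk a⁻¹ (by positivity)
      have e : a⁻¹ * a = 1 := inv_mul_cancel₀ ha0.ne'
      have e1 : a⁻¹ < 1 := inv_lt_one_of_one_lt₀ h
      have e2 : a⁻¹ * b ≤ 1 := by rw [← e]; exact mul_le_mul_of_nonneg_left hab (by positivity)
      rw [e, sub_self, abs_zero, abs_of_neg (by linarith),
        abs_of_nonneg (show 0 ≤ 1 - a⁻¹ * b by linarith)] at h1
      rcases le_or_gt b 1 with hb | hb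
      · rw [abs_of_nonneg (by linarith)] at h1
        nlinarith
      · rw [abs_of_neg (by linarith)] at h1
        have h3 : 0 ≤ (1 - a⁻¹) * t := mul_nonneg (by linarith) (by linarith)
        have h4 : 0 < (b - 1) * a⁻¹ := mul_pos (sub_pos.2 hb) (by positivity)
        have h5 : 0 < (a - 1) * (1 - a⁻¹) := mul_pos (sub_pos.2 h) (by linarith)
        linarith
  left
  subst ha1
  rw [abs_of_nonneg (by linarith : 0 ≤ 1 - b)] at h2
  simp at h2
  exact ⟨rfl, by linarith, hab⟩

lemma det_of_minimal {V : Mat4} (hV : Uncertain V) (hI : Inseparable V) {S T : Mat2}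
    (hmin : ∀ S' T', cost V S T ≤ cost V S' T') :
    (S.det = 1 ∧ 0 < T.det ∧ T.det ≤ 1) ∨ (T.det = 1 ∧ 0 < S.det ∧ S.det ≤ 1) := by
  refine eq_one_of_minimal_on_ray (t := halfTrace V S T) (fun k hk => ?_) (hV.abs_sub_le S T) ?_
  · have h := hmin (√k • S) (√k • T)
    simpa only [cost, halfTrace_smul, det_smul, Fintype.card_fin, Real.sq_sqrt hk] using h
  · obtain ⟨S', T', h⟩ := hI.exists_cost_lt_two
    exact (hmin S' T').trans_lt h

/-! ### Stationarity at a minimum and the normal form -/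

lemma linear_coeff_eq_zero {L Q δ : ℝ} (hδ : 0 < δ)
    (h : ∀ ε : ℝ, |ε| ≤ δ → 0 ≤ L * ε + Q * ε ^ 2) : L = 0 := by
  by_contra hL
  have hL' : 0 < |L| := abs_pos.2 hL
  -- The step `-L / K` stays within `δ`, and there the polynomial equals `(L² / K²) (Q - K) < 0`.
  set K : ℝ := 1 + |L| / δ + |Q| with hK
  have hK0 : 0 < K := by positivity
  have hε : |(-L / K)| ≤ δ := by
    rw [abs_div, abs_neg, abs_of_pos hK0, div_le_iff₀ hK0, hK]
    have : δ * (|L| / δ) = |L| := by field_simp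
    nlinarith [abs_nonneg Q]
  have h1 := h _ hε
  have h2 : L * (-L / K) + Q * (-L / K) ^ 2 = (L ^ 2 / K ^ 2) * (Q - K) := by
    field_simp; ring
  rw [h2] at h1
  have h3 : Q - K < 0 := by
    have : 0 < |L| / δ := by positivity
    linarith [le_abs_self Q]
  have h4 : 0 < L ^ 2 / K ^ 2 := by positivity
  nlinarith

/-- First order conditions at a minimum of the half trace among pairs of given determinants. -/
lemma stationary_of_minimal {V : Mat4} (hV : Uncertain V) {η : ℝ} (hη : 0 < η)
    (hmin : ∀ S T : Mat2, S.det = 1 → T.det = η ^ 2 →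
      halfTrace V 1 (η • (1 : Mat2)) ≤ halfTrace V S T) :
    V (.inl 1) (.inr 0) = - V (.inl 0) (.inr 1) ∧
    V (.inl 0) (.inl 1) = η * V (.inl 0) (.inr 1) ∧
    η * V (.inr 0) (.inr 1) = - V (.inl 0) (.inr 1) ∧
    V (.inl 0) (.inl 0) + η * V (.inl 0) (.inr 0)
      = V (.inl 1) (.inl 1) - η * V (.inl 1) (.inr 1) ∧
    η * V (.inr 0) (.inr 0) + V (.inl 0) (.inr 0)
      = η * V (.inr 1) (.inr 1) - V (.inl 1) (.inr 1) := by
  have e : ∀ i j, V i j = V j i := fun i j => congrFun (congrFun hV.symm j) i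
  -- Perturb by `1 + ε X` with `X` nilpotent: the determinant stays exactly `1` and the half trace
  -- is a quadratic polynomial in `ε`.
  have hS : ∀ a b c : ℝ, a ^ 2 = - (b * c) → ∀ ε : ℝ,
      (!![1 + ε * a, ε * b; ε * c, 1 - ε * a] : Mat2).det = 1 := by
    intro a b c h ε
    rw [det_fin_two_of]; linear_combination - ε ^ 2 * h
  have hT : ∀ a b c : ℝ, a ^ 2 = - (b * c) → ∀ ε : ℝ,
      (η • (!![1 + ε * a, ε * b; ε * c, 1 - ε * a] : Mat2)).det = η ^ 2 := by
    intro a b c h ε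
    rw [det_smul, hS a b c h]; simp
  have h1η : (η • (1 : Mat2)).det = η ^ 2 := by simp
  simp only [halfTrace_eq_quadForm, quadForm, dotProduct, mulVec, Fintype.sum_sum_type,
    Fin.sum_univ_two, Sum.elim_inl, Sum.elim_inr, Pi.neg_apply, e (.inl 1) (.inl 0),
    e (.inr 1) (.inr 0), e (.inr 0) (.inl 0), e (.inr 0) (.inl 1), e (.inr 1) (.inl 0),
    e (.inr 1) (.inl 1)] at hmin
  set a11 := V (.inl 0) (.inl 0); set a12 := V (.inl 0) (.inl 1); set a22 := V (.inl 1) (.inl 1)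
  set b11 := V (.inr 0) (.inr 0); set b12 := V (.inr 0) (.inr 1); set b22 := V (.inr 1) (.inr 1)
  set c11 := V (.inl 0) (.inr 0); set c12 := V (.inl 0) (.inr 1)
  set c21 := V (.inl 1) (.inr 0); set c22 := V (.inl 1) (.inr 1)
  have hA : ∀ a b c : ℝ, a ^ 2 = - (b * c) →
      a * ((a11 + η * c11) - (a22 - η * c22)) + b * (a12 + η * c21) + c * (a12 - η * c12) = 0 := by
    intro a b c h
    refine linear_coeff_eq_zero one_pos (Q := ((a11 * a ^ 2 + 2 * a12 * a * b + a22 * b ^ 2)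
      + (a11 * c ^ 2 - 2 * a12 * a * c + a22 * a ^ 2)) / 2) fun ε _ => ?_
    have := hmin _ (η • 1) (hS a b c h ε) h1η
    simp at this
    linarith
  have hB : ∀ a b c : ℝ, a ^ 2 = - (b * c) →
      η * (a * ((η * b11 + c11) - (η * b22 - c22)) + b * (η * b12 + c12)
        + c * (η * b12 - c21)) = 0 := by
    intro a b c h
    refine linear_coeff_eq_zero one_pos (Q := η ^ 2 * ((b11 * a ^ 2 + 2 * b12 * a * b + b22 * b ^ 2)
      + (b11 * c ^ 2 - 2 * b12 * a * c + b22 * a ^ 2)) / 2) fun ε _ => ?_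
    have := hmin 1 _ det_one (hT a b c h ε)
    simp at this
    linarith
  -- These three nilpotent matrices span the traceless ones.
  have A1 := hA 0 1 0 (by norm_num)
  have A2 := hA 0 0 1 (by norm_num)
  have A3 := hA 1 (-1) 1 (by norm_num)
  have B1 := (mul_eq_zero.1 (hB 0 1 0 (by norm_num))).resolve_left hη.ne'
  have B2 := (mul_eq_zero.1 (hB 0 0 1 (by norm_num))).resolve_left hη.ne'
  have B3 := (mul_eq_zero.1 (hB 1 (-1) 1 (by norm_num))).resolve_left hη.ne'
  refine ⟨?_, ?_, ?_, ?_, ?_⟩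
  · linarith
  · linarith
  · linarith
  · linarith
  · linarith

/-- Correlation matrices for which `(1, η)` is a critical point of the half trace, with Lagrange
multipliers `α, β`. -/
noncomputable def criticalCM (η α β d e : ℝ) : Mat4 :=
  fromBlocks !![α + η * e, 0; 0, α + η * d] !![-e, 0; 0, d]
    !![-e, 0; 0, d] !![β + e / η, 0; 0, β + d / η]

lemma isNormalForm_criticalCM {η α β d e : ℝ} (hη : 0 < η)
    (hV : Uncertain (criticalCM η α β d e)) (hd : 0 < d) (he : 0 < e) :
    IsNormalForm η (α + η * d) (β + d / η) d (η * (e - d)) (criticalCM η α β d e) := by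
  have hpos : ∀ i, 0 < criticalCM η α β d e i i := fun i => by
    have h := hV.quadForm_pos (p := Pi.single i 1) (by simp)
    simpa [quadForm] using h
  have h1 : α + η * d + η * (e - d) = α + η * e := by ring
  have h2 : β + d / η + η * (e - d) / η ^ 2 = β + e / η := by field_simp; ring
  have h3 : d + η * (e - d) / η = e := by field_simp; ring
  have h4 : -d - η * (e - d) / η = -e := by field_simp; ring
  refine ⟨?_, by simpa [criticalCM] using hpos (.inl 1), ?_,
    by simpa [criticalCM] using hpos (.inr 1), by rwa [h3], hd, ?_⟩
  · rw [h1]; simpa [criticalCM] using hpos (.inl 0)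
  · rw [h2]; simpa [criticalCM] using hpos (.inr 0)
  · rw [h1, h2, h4, criticalCM]

lemma IsNormalForm.eq_criticalCM {η n m d lam : ℝ} {V : Mat4} (hη : 0 < η)
    (h : IsNormalForm η n m d lam V) :
    V = criticalCM η (n - η * d) (m - d / η) d (d + lam / η) := by
  have h1 : n - η * d + η * (d + lam / η) = n + lam := by field_simp; ring
  have h2 : m - d / η + (d + lam / η) / η = m + lam / η ^ 2 := by field_simp; ring
  have h3 : n - η * d + η * d = n := by ring
  have h4 : m - d / η + d / η = m := by ring
  have h5 : -(d + lam / η) = -d - lam / η := by ring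
  rw [criticalCM, h1, h2, h3, h4, h5]
  exact h.eq

/-- Every square vanishes at `(1, η)`, which exhibits `α` and `β` as Lagrange multipliers. All later
estimates and all tests of the uncertainty principle on normal forms start from this identity. -/
lemma halfTrace_criticalCM {η : ℝ} (hη : 0 < η) (α β d e : ℝ) (S T : Mat2) :
    halfTrace (criticalCM η α β d e) S T = α * S.det + β * T.det
      + (α * ((S 0 0 - S 1 1) ^ 2 + (S 0 1 + S 1 0) ^ 2)
        + β * ((T 0 0 - T 1 1) ^ 2 + (T 0 1 + T 1 0) ^ 2)
        + e / η * ((η * S 0 0 - T 0 0) ^ 2 + (η * S 1 0 + T 1 0) ^ 2)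
        + d / η * ((η * S 1 1 - T 1 1) ^ 2 + (η * S 0 1 + T 0 1) ^ 2)) / 2 := by
  simp only [halfTrace_eq_quadForm, quadForm, dotProduct, mulVec, Fintype.sum_sum_type,
    Fin.sum_univ_two, Sum.elim_inl, Sum.elim_inr, Pi.neg_apply, criticalCM, det_fin_two,
    fromBlocks_apply₁₁, fromBlocks_apply₁₂, fromBlocks_apply₂₁, fromBlocks_apply₂₂, of_apply,
    cons_val', cons_val_zero, cons_val_one, cons_val_fin_one]
  field_simp
  ring

lemma bareNoise_criticalCM {η : ℝ} (hη : 0 < η) (α β d e : ℝ) :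
    bareNoise (criticalCM η α β d e) 1 (η • (1 : Mat2)) = (α + η ^ 2 * β) • (1 : Mat2) := by
  ext i j
  fin_cases i <;> fin_cases j <;>
    simp [bareNoise, criticalCM, Z]
  all_goals field_simp; ring

lemma halfTrace_criticalCM_one {η : ℝ} (hη : 0 < η) (α β d e : ℝ) :
    halfTrace (criticalCM η α β d e) 1 (η • (1 : Mat2)) = α + η ^ 2 * β := by
  rw [halfTrace, bareNoise_criticalCM hη]; simp

/-- If both correlation coefficients have the same sign, the partial transpose satisfies the
uncertainty principle as well. -/
lemma le_of_correlations_same_sign {n₁ n₂ m₁ m₂ c₁ c₂ : ℝ} (hc : 0 ≤ c₁ * c₂)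
    (h : ∀ u₁ u₂ v₁ v₂ : ℝ, 2 * (u₁ * v₁ + u₂ * v₂) ≤ n₁ * u₁ ^ 2 + 2 * c₁ * u₁ * u₂ + m₁ * u₂ ^ 2
      + n₂ * v₁ ^ 2 + 2 * c₂ * v₁ * v₂ + m₂ * v₂ ^ 2) (u₁ u₂ v₁ v₂ : ℝ) :
    2 * (-(u₁ * v₁) + u₂ * v₂) ≤ n₁ * u₁ ^ 2 + 2 * c₁ * u₁ * u₂ + m₁ * u₂ ^ 2
      + n₂ * v₁ ^ 2 + 2 * c₂ * v₁ * v₂ + m₂ * v₂ ^ 2 := by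
  have hu := h (-u₁) u₂ v₁ v₂
  have hv := h u₁ u₂ (-v₁) v₂
  have hp := h u₁ u₂ v₁ v₂
  have hm := h (-u₁) (-u₂) v₁ v₂
  -- If one correlation term is nonnegative, flipping the sign of `u₁` or of `v₁` only helps. If
  -- both are negative, `u₁ v₁` and `u₂ v₂` have the same sign, and the unflipped inequality or the
  -- one with both `u` flipped suffices.
  rcases le_or_gt 0 (c₁ * (u₁ * u₂)) with h1 | h1
  · linarith
  rcases le_or_gt 0 (c₂ * (v₁ * v₂)) with h2 | h2
  · linarith
  have h3 : 0 < (c₁ * c₂) * ((u₁ * v₁) * (u₂ * v₂)) := by nlinarith [mul_pos_of_neg_of_neg h1 h2]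
  have h4 : 0 < (u₁ * v₁) * (u₂ * v₂) := by
    by_contra! hneg
    nlinarith
  rcases pos_and_pos_or_neg_and_neg_of_mul_pos h4 with ⟨h5, h6⟩ | ⟨h5, h6⟩ <;> linarith

/-- The correlations are `-e` and `d`; if `d e ≤ 0`, the partial transpose is uncertain too. The
form separates into the diagonal and the off-diagonal entries of `S` and `T`, and the sign
inequality is applied to each group. -/
lemma Inseparable.mul_pos_of_criticalCM {η α β d e : ℝ} (hη : 0 < η)
    (hV : Uncertain (criticalCM η α β d e)) (hI : Inseparable (criticalCM η α β d e)) :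
    0 < d * e := by
  by_contra! hde
  obtain ⟨S, T, h⟩ := hI
  have hE : ∀ u₁ u₂ v₁ v₂ : ℝ, 2 * (u₁ * v₁ + u₂ * v₂)
      ≤ (α + η * e) * u₁ ^ 2 + 2 * (-e) * u₁ * u₂ + (β + e / η) * u₂ ^ 2
      + (α + η * d) * v₁ ^ 2 + 2 * d * v₁ * v₂ + (β + d / η) * v₂ ^ 2 := by
    intro u₁ u₂ v₁ v₂
    have h1 := hV.le_halfTrace !![u₁, 0; 0, -v₁] !![u₂, 0; 0, v₂]
    rw [halfTrace_criticalCM hη] at h1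
    simp at h1
    have e1 : e / η * (η * u₁ - u₂) ^ 2 = η * e * u₁ ^ 2 - 2 * e * u₁ * u₂ + e / η * u₂ ^ 2 := by
      field_simp; ring
    have e2 : d / η * (-(η * v₁) - v₂) ^ 2
        = η * d * v₁ ^ 2 + 2 * d * v₁ * v₂ + d / η * v₂ ^ 2 := by
      field_simp; ring
    rw [e1, e2] at h1
    linarith
  have f := le_of_correlations_same_sign (by linarith) hE
  have f1 := f (S 0 0) (T 0 0) (-S 1 1) (T 1 1)
  have f2 := f (S 1 0) (-T 1 0) (S 0 1) (T 0 1)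
  rw [halfTrace_criticalCM hη, det_fin_two, det_fin_two] at h
  have e1 : ∀ x y : ℝ, e / η * (η * x - y) ^ 2 = η * e * x ^ 2 - 2 * e * x * y + e / η * y ^ 2 := by
    intro x y; field_simp; ring
  have e2 : ∀ x y : ℝ, d / η * (η * x - y) ^ 2 = η * d * x ^ 2 - 2 * d * x * y + d / η * y ^ 2 := by
    intro x y; field_simp; ring
  have e3 : ∀ x y : ℝ, e / η * (η * x + y) ^ 2 = η * e * x ^ 2 + 2 * e * x * y + e / η * y ^ 2 := by
    intro x y; field_simp; ring
  have e4 : ∀ x y : ℝ, d / η * (η * x + y) ^ 2 = η * d * x ^ 2 + 2 * d * x * y + d / η * y ^ 2 := by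
    intro x y; field_simp; ring
  rw [mul_add (e / η), mul_add (d / η), e1, e2, e3, e4] at h
  nlinarith

/-- A correlation matrix for which `(1, η)` minimizes the cost is in normal form, once the
correlations have been diagonalized. -/
lemma isNormalForm_of_minimal {V : Mat4} (hV : Uncertain V) (hI : Inseparable V) {η : ℝ}
    (hη : 0 < η) (h1 : η ≤ 1) (hmin : ∀ S T, cost V 1 (η • (1 : Mat2)) ≤ cost V S T)
    (hC : V (.inl 0) (.inr 1) = 0) :
    ∃ n m d lam : ℝ, IsNormalForm η n m d lam V ∧ (η < 1 → η = d / (m - 1)) := by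
  have hmin' : ∀ S T : Mat2, S.det = 1 → T.det = η ^ 2 →
      halfTrace V 1 (η • (1 : Mat2)) ≤ halfTrace V S T := by
    intro S T hS hT
    have := hmin S T
    simp only [cost, hS, hT, det_one, det_smul, Fintype.card_fin, mul_one] at this
    linarith
  obtain ⟨s1, s2, s3, s4, s5⟩ := stationary_of_minimal hV hη hmin'
  rw [hC, neg_zero] at s1 s3
  rw [hC, mul_zero] at s2
  have s3' := (mul_eq_zero.1 s3).resolve_left hη.ne'
  have e : ∀ i j, V i j = V j i := fun i j => congrFun (congrFun hV.symm j) i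
  obtain ⟨α, β, d, e', hVeq⟩ : ∃ α β d e : ℝ, V = criticalCM η α β d e := by
    refine ⟨V (.inl 0) (.inl 0) + η * V (.inl 0) (.inr 0),
      V (.inr 0) (.inr 0) + V (.inl 0) (.inr 0) / η, V (.inl 1) (.inr 1), -V (.inl 0) (.inr 0), ?_⟩
    have hb : V (.inr 1) (.inr 1) = V (.inr 0) (.inr 0) + V (.inl 0) (.inr 0) / η
        + V (.inl 1) (.inr 1) / η := by
      field_simp; linarith
    ext (i | i) (j | j) <;> fin_cases i <;> fin_cases j <;>
      simp [criticalCM, hC, s1, s2, s3', e (.inl 1) (.inl 0),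
        e (.inr 1) (.inr 0), e (.inr 0) (.inl 0), e (.inr 0) (.inl 1), e (.inr 1) (.inl 0),
        e (.inr 1) (.inl 1), hb]
    · linarith
    · field_simp; ring
  subst hVeq
  have hde := hI.mul_pos_of_criticalCM hη hV
  -- `(1, -η)` has the same determinants as `(1, η)`; comparing the two fixes the common sign of `d`
  -- and `e'`.
  have hsum : 0 ≤ d + e' := by
    have hneg : (-η • (1 : Mat2)).det = η ^ 2 := by rw [det_smul]; simp
    have h := hmin' 1 (-η • (1 : Mat2)) det_one hneg
    rw [halfTrace_criticalCM_one hη, halfTrace_criticalCM hη, hneg] at h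
    simp at h
    have x1 : e' / η * (η + η) ^ 2 = 4 * η * e' := by field_simp; ring
    have x2 : d / η * (η + η) ^ 2 = 4 * η * d := by field_simp; ring
    rw [x1, x2] at h
    nlinarith
  have hd : 0 < d := by
    rcases pos_and_pos_or_neg_and_neg_of_mul_pos hde with h | h <;> linarith
  have he : 0 < e' := by
    rcases pos_and_pos_or_neg_and_neg_of_mul_pos hde with h | h <;> linarith
  refine ⟨_, _, _, _, isNormalForm_criticalCM hη hV hd he, fun hlt => ?_⟩
  have hβ : β = 1 := by
    -- The derivative of the cost in `η`. Since `η < 1`, small variations of both signs keep Bob's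
    -- determinant below `1`.
    have hL : 2 * η * (β - 1) = 0 := by
      refine linear_coeff_eq_zero (δ := min η (1 - η)) (lt_min hη (by linarith))
        (Q := β - 1 + (d + e') / (2 * η)) fun ε hε => ?_
      have hε1 := abs_le.1 (hε.trans (min_le_left _ _))
      have hε2 := abs_le.1 (hε.trans (min_le_right _ _))
      have h := hmin 1 ((η + ε) • (1 : Mat2))
      rw [cost, cost, halfTrace_criticalCM_one hη, halfTrace_criticalCM hη] at h
      simp only [det_one, det_smul, Fintype.card_fin, mul_one] at h
      rw [abs_of_nonneg (show 0 ≤ 1 - η ^ 2 by nlinarith),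
        abs_of_nonneg (show 0 ≤ 1 - (η + ε) ^ 2 by nlinarith)] at h
      simp at h
      have x1 : (d + e') / (2 * η) * ε ^ 2 = e' / η * ε ^ 2 / 2 + d / η * ε ^ 2 / 2 := by
        field_simp
        ring
      linarith
    have := (mul_eq_zero.1 hL).resolve_left (by positivity)
    linarith
  rw [hβ]
  field_simp
  ring_nf
  field_simp

/-! ### Invariance under symplectic maps and phase rotations -/

lemma halfTrace_apply {σ : LocalTGCP} (hσ : σ.IsSymplectic) (V : Mat4) (S T : Mat2) :
    halfTrace (σ.apply V) S T = halfTrace V (S * σ.alice.S) (T * σ.bob.S) := by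
  rw [halfTrace, bareNoise_apply σ hσ, halfTrace]

lemma LocalTGCP.IsSymplectic.det_alice {σ : LocalTGCP} (hσ : σ.IsSymplectic) :
    σ.alice.S.det = 1 := (mul_J_mul_transpose_eq_J_iff _).1 hσ.1.1

lemma LocalTGCP.IsSymplectic.det_bob {σ : LocalTGCP} (hσ : σ.IsSymplectic) :
    σ.bob.S.det = 1 := (mul_J_mul_transpose_eq_J_iff _).1 hσ.2.1

lemma cost_apply {σ : LocalTGCP} (hσ : σ.IsSymplectic) (V : Mat4) (S T : Mat2) :
    cost (σ.apply V) S T = cost V (S * σ.alice.S) (T * σ.bob.S) := by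
  simp only [cost, halfTrace_apply hσ, det_mul, hσ.det_alice, hσ.det_bob, mul_one]

lemma Uncertain.apply {V : Mat4} (hV : Uncertain V) {σ : LocalTGCP} (hσ : σ.IsSymplectic) :
    Uncertain (σ.apply V) where
  symm := by
    simp only [LocalTGCP.apply, hσ.1.2, hσ.2.2, fromBlocks_zero, add_zero, transpose_mul,
      transpose_transpose, hV.symm, Matrix.mul_assoc]
  le_halfTrace S T := by
    have h := hV.le_halfTrace (S * σ.alice.S) (T * σ.bob.S)
    rw [halfTrace_apply hσ]
    simpa only [det_mul, hσ.det_alice, hσ.det_bob, mul_one] using h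

lemma mul_inv_mul_of_det_one {S : Mat2} (hS : S.det = 1) (M : Mat2) :
    M * S⁻¹ * S = M :=
  nonsing_inv_mul_cancel_right _ _ (by rw [hS]; exact isUnit_one)

lemma Inseparable.apply {V : Mat4} (hI : Inseparable V) {σ : LocalTGCP} (hσ : σ.IsSymplectic) :
    Inseparable (σ.apply V) := by
  obtain ⟨S, T, h⟩ := hI
  refine ⟨S * σ.alice.S⁻¹, T * σ.bob.S⁻¹, ?_⟩
  rw [halfTrace_apply hσ, mul_inv_mul_of_det_one hσ.det_alice,
    mul_inv_mul_of_det_one hσ.det_bob]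
  simpa [det_mul, hσ.det_alice, hσ.det_bob, det_nonsing_inv] using h

lemma LocalTGCP.comp_apply (f g : LocalTGCP) (V : Mat4) :
    (f.comp g).apply V = f.apply (g.apply V) := by
  simp only [LocalTGCP.apply_eq, LocalTGCP.comp, TGCP.comp, toBlocks_fromBlocks₁₁,
    toBlocks_fromBlocks₁₂, toBlocks_fromBlocks₂₁, toBlocks_fromBlocks₂₂, transpose_mul,
    Matrix.mul_add, Matrix.add_mul, Matrix.mul_assoc, add_assoc]

/-- The matrix of a phase rotation. -/
noncomputable def rotationMatrix (θ : ℝ) : Mat2 :=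
  !![Real.cos θ, -Real.sin θ; Real.sin θ, Real.cos θ]

lemma rotationMatrix_mul_neg (θ : ℝ) : rotationMatrix θ * rotationMatrix (-θ) = 1 := by
  ext i j
  fin_cases i <;> fin_cases j <;>
    simp [rotationMatrix] <;>
    nlinarith [Real.sin_sq_add_cos_sq θ]

lemma rotationMatrix_neg_mul (θ : ℝ) : rotationMatrix (-θ) * rotationMatrix θ = 1 := by
  simpa using rotationMatrix_mul_neg (-θ)

lemma rotationMatrix_transpose (θ : ℝ) : (rotationMatrix θ)ᵀ = rotationMatrix (-θ) := by
  ext i j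
  fin_cases i <;> fin_cases j <;> simp [rotationMatrix]

lemma det_rotationMatrix (θ : ℝ) : (rotationMatrix θ).det = 1 := by
  simp only [rotationMatrix, det_fin_two_of]
  nlinarith [Real.sin_sq_add_cos_sq θ]

lemma Z_rotationMatrix_Z (θ : ℝ) : Z * rotationMatrix θ * Z = rotationMatrix (-θ) := by
  ext i j
  fin_cases i <;> fin_cases j <;> simp [rotationMatrix, Z]

lemma LocalTGCP.isSymplectic_phaseRotation (θ : ℝ) : (phaseRotation θ).IsSymplectic := by
  refine ⟨⟨?_, rfl⟩, ⟨?_, rfl⟩⟩ <;> rw [mul_J_mul_transpose_eq_J_iff]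
  · exact det_rotationMatrix (-θ)
  · exact det_rotationMatrix θ

lemma noise_eq_bareNoise (V : Mat4) : noise V = bareNoise V 1 1 := by
  simp [noise, bareNoise]

lemma fidelity_phaseRotation (θ : ℝ) (V : Mat4) :
    fidelity ((LocalTGCP.phaseRotation θ).apply V) = fidelity V := by
  have hn : noise ((LocalTGCP.phaseRotation θ).apply V)
      = rotationMatrix θ * noise V * (rotationMatrix θ)ᵀ := by
    rw [noise_eq_bareNoise, bareNoise_apply _ (LocalTGCP.isSymplectic_phaseRotation θ),
      noise_eq_bareNoise, ← bareNoise_mul_left, Z_rotationMatrix_Z]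
    simp [LocalTGCP.phaseRotation, LocalTGCP.rotation, TGCP.ofSymplectic, rotationMatrix]
  have h2 : (2 : ℝ) • (1 : Mat2) + rotationMatrix θ * noise V * (rotationMatrix θ)ᵀ
      = rotationMatrix θ * ((2 : ℝ) • (1 : Mat2) + noise V) * (rotationMatrix θ)ᵀ := by
    rw [rotationMatrix_transpose, Matrix.mul_add, Matrix.add_mul, Matrix.mul_smul, Matrix.smul_mul,
      Matrix.mul_one, rotationMatrix_mul_neg]
  rw [fidelity, gaussianFidelity, hn, h2, det_mul, det_mul, det_transpose, det_rotationMatrix,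
    one_mul, mul_one, fidelity, gaussianFidelity]

lemma isOptimal_phaseRotation_comp {V : Mat4} {κ : LocalTGCP} {θ : ℝ} :
    IsOptimal V ((LocalTGCP.phaseRotation θ).comp κ) ↔ IsOptimal V κ := by
  simp only [IsOptimal, LocalTGCP.comp_apply, fidelity_phaseRotation]

/-! ### Exchange of the two modes -/

section Swap

/-- Exchange of the names of the modes. -/
def LocalTGCP.swap (ω : LocalTGCP) : LocalTGCP := ⟨ω.bob, ω.alice⟩

lemma swapModes_swapModes (V : Mat4) : swapModes (swapModes V) = V := by
  ext i j; simp [swapModes]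

lemma bareNoise_swapModes (V : Mat4) (S T : Mat2) :
    bareNoise (swapModes V) S T = Z * bareNoise V T S * Z := by
  have h11 : (swapModes V).toBlocks₁₁ = V.toBlocks₂₂ := rfl
  have h12 : (swapModes V).toBlocks₁₂ = V.toBlocks₂₁ := rfl
  have h21 : (swapModes V).toBlocks₂₁ = V.toBlocks₁₂ := rfl
  have h22 : (swapModes V).toBlocks₂₂ = V.toBlocks₁₁ := rfl
  have hZ : ∀ M : Mat2, Z * (Z * M) = M := fun M => by
    rw [← Matrix.mul_assoc, Z_mul_Z, Matrix.one_mul]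
  simp only [bareNoise, h11, h12, h21, h22, Matrix.mul_add, Matrix.add_mul, Matrix.mul_assoc, hZ,
    Z_mul_Z, Matrix.mul_one]
  abel

lemma halfTrace_swapModes (V : Mat4) (S T : Mat2) :
    halfTrace (swapModes V) S T = halfTrace V T S := by
  rw [halfTrace, bareNoise_swapModes, trace_mul_comm, ← Matrix.mul_assoc, Z_mul_Z, Matrix.one_mul,
    halfTrace]

lemma Uncertain.swapModes {V : Mat4} (hV : Uncertain V) : Uncertain (swapModes V) where
  symm := by
    ext i j
    exact congrFun (congrFun hV.symm i.swap) j.swap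
  le_halfTrace S T := by
    rw [halfTrace_swapModes]
    refine (le_abs_self _).trans ?_
    rw [abs_sub_comm]
    exact hV.abs_sub_le T S

lemma Inseparable.swapModes {V : Mat4} (hI : Inseparable V) : Inseparable (swapModes V) := by
  obtain ⟨S, T, h⟩ := hI
  exact ⟨T, S, by rw [halfTrace_swapModes]; linarith⟩

lemma LocalTGCP.swap_apply_swapModes (ω : LocalTGCP) (V : Mat4) :
    ω.swap.apply (swapModes V) = swapModes (ω.apply V) := by
  rw [LocalTGCP.apply_eq, LocalTGCP.apply_eq]
  ext (i | i) (j | j) <;> rfl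

lemma fidelity_swapModes (V : Mat4) : fidelity (swapModes V) = fidelity V := by
  have hn : noise (swapModes V) = Z * noise V * Z := by
    rw [noise_eq_bareNoise, bareNoise_swapModes, ← noise_eq_bareNoise]
  have h2 : (2 : ℝ) • (1 : Mat2) + Z * noise V * Z = Z * ((2 : ℝ) • (1 : Mat2) + noise V) * Z := by
    rw [Matrix.mul_add, Matrix.add_mul, Matrix.mul_smul, Matrix.smul_mul, Matrix.mul_one, Z_mul_Z]
  rw [fidelity, gaussianFidelity, hn, h2, det_mul, det_mul, det_Z, fidelity, gaussianFidelity]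
  simp

lemma IsOptimal.swap {V : Mat4} {ω : LocalTGCP} (h : IsOptimal V ω) :
    IsOptimal (swapModes V) ω.swap := fun ω' => by
  have h' := h ω'.swap
  rw [LocalTGCP.swap_apply_swapModes, fidelity_swapModes]
  have e : ω'.apply (swapModes V) = swapModes (ω'.swap.apply V) :=
    LocalTGCP.swap_apply_swapModes ω'.swap V
  rw [e, fidelity_swapModes]
  exact h'

lemma isOptimal_swapModes_iff {V : Mat4} {ω : LocalTGCP} :
    IsOptimal (swapModes V) ω.swap ↔ IsOptimal V ω := by
  refine ⟨fun h => ?_, IsOptimal.swap⟩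
  have := h.swap
  rwa [swapModes_swapModes] at this

lemma LocalTGCP.IsSymplectic.swap {σ : LocalTGCP} (h : σ.IsSymplectic) : σ.swap.IsSymplectic :=
  ⟨h.2, h.1⟩

end Swap

/-! ### Canonical form of optimal maps -/

/-- The rotated symplectic part of a map with determinants `1` and `η²`. -/
noncomputable def LocalTGCP.symplecticPart (S T : Mat2) (η : ℝ) (hS : S.det = 1)
    (hT : T.det = η ^ 2) (hη : η ≠ 0) (θ : ℝ) : LocalTGCP :=
  ⟨TGCP.ofSymplectic (rotationMatrix θ * S) ((mul_J_mul_transpose_eq_J_iff _).2 (by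
      rw [det_mul, det_rotationMatrix, hS, one_mul])),
    TGCP.ofSymplectic (rotationMatrix (-θ) * (η⁻¹ • T)) ((mul_J_mul_transpose_eq_J_iff _).2 (by
      rw [det_mul, det_rotationMatrix, det_smul, hT, Fintype.card_fin, one_mul, ← mul_pow,
        inv_mul_cancel₀ hη, one_pow]))⟩

section SymplecticPart

variable {S T : Mat2} {η : ℝ} (hS : S.det = 1) (hT : T.det = η ^ 2)

lemma LocalTGCP.isSymplectic_symplecticPart (hη : η ≠ 0) (θ : ℝ) :
    (symplecticPart S T η hS hT hη θ).IsSymplectic := by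
  refine ⟨⟨(mul_J_mul_transpose_eq_J_iff _).2 ?_, rfl⟩, ⟨(mul_J_mul_transpose_eq_J_iff _).2 ?_, rfl⟩⟩
  · change (rotationMatrix θ * S).det = 1
    rw [det_mul, det_rotationMatrix, hS, one_mul]
  · change (rotationMatrix (-θ) * (η⁻¹ • T)).det = 1
    rw [det_mul, det_rotationMatrix, det_smul, hT, Fintype.card_fin, one_mul, ← mul_pow,
      inv_mul_cancel₀ hη, one_pow]

lemma cost_symplecticPart_apply (hη : η ≠ 0) (θ : ℝ) (V : Mat4) :
    cost ((LocalTGCP.symplecticPart S T η hS hT hη θ).apply V) 1 (η • (1 : Mat2)) = cost V S T := by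
  rw [cost_apply (LocalTGCP.isSymplectic_symplecticPart hS hT hη θ)]
  change cost V (1 * (rotationMatrix θ * S)) (η • (1 : Mat2) * (rotationMatrix (-θ) * (η⁻¹ • T))) = _
  have e1 : (1 : Mat2) * (rotationMatrix θ * S) = Z * rotationMatrix (-θ) * Z * S := by
    rw [Z_rotationMatrix_Z, neg_neg, Matrix.one_mul]
  have e2 : η • (1 : Mat2) * (rotationMatrix (-θ) * (η⁻¹ • T)) = rotationMatrix (-θ) * T := by
    rw [Matrix.smul_mul, Matrix.one_mul, Matrix.mul_smul, smul_smul, mul_inv_cancel₀ hη, one_smul]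
  have e3 : (rotationMatrix (-θ))ᵀ * rotationMatrix (-θ) = 1 := by
    rw [rotationMatrix_transpose]; exact rotationMatrix_neg_mul (-θ)
  rw [e1, e2, cost, cost, halfTrace_mul_left_of_orthogonal V e3]
  simp only [det_mul, det_rotationMatrix, det_Z]
  norm_num

lemma symplecticPart_apply_inl_inr (hη : η ≠ 0) (θ : ℝ) (V : Mat4) (i j : Fin 2) :
    ((LocalTGCP.symplecticPart S T η hS hT hη θ).apply V) (.inl i) (.inr j)
      = (rotationMatrix θ * (S * V.toBlocks₁₂ * (η⁻¹ • T)ᵀ) * rotationMatrix θ) i j := by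
  rw [LocalTGCP.apply_eq, fromBlocks_apply₁₂]
  change ((rotationMatrix θ * S) * V.toBlocks₁₂ * (rotationMatrix (-θ) * (η⁻¹ • T))ᵀ) i j = _
  rw [transpose_mul, rotationMatrix_transpose, neg_neg]
  simp only [Matrix.mul_assoc]

/-- The rotation turns the correlation block `C` into `R_θ C R_θ`. Its upper right entry is `C₀₁` at
`θ = 0` and `C₁₀ = -C₀₁` at `θ = π / 2`, so it vanishes in between. -/
lemma exists_symplecticPart_apply_eq_zero (hη : η ≠ 0) (V : Mat4)
    (hanti : ∀ θ, ((LocalTGCP.symplecticPart S T η hS hT hη θ).apply V) (.inl 1) (.inr 0)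
      = - ((LocalTGCP.symplecticPart S T η hS hT hη θ).apply V) (.inl 0) (.inr 1)) :
    ∃ θ, ((LocalTGCP.symplecticPart S T η hS hT hη θ).apply V) (.inl 0) (.inr 1) = 0 := by
  simp only [symplecticPart_apply_inl_inr] at hanti ⊢
  generalize S * V.toBlocks₁₂ * (η⁻¹ • T)ᵀ = C at hanti ⊢
  have hentry : ∀ θ, (rotationMatrix θ * C * rotationMatrix θ) 0 1 = Real.cos θ ^ 2 * C 0 1
      + Real.sin θ ^ 2 * C 1 0 - Real.sin θ * Real.cos θ * (C 0 0 + C 1 1) := by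
    intro θ
    simp [rotationMatrix, Matrix.mul_apply, Fin.sum_univ_two, vecMul, dotProduct]
    ring
  have hc0 : C 1 0 = - C 0 1 := by
    have h := hanti 0
    simpa [rotationMatrix, Matrix.mul_apply, Fin.sum_univ_two, vecMul, dotProduct] using h
  simp only [hentry]
  have hcont : Continuous fun θ => Real.cos θ ^ 2 * C 0 1
      + Real.sin θ ^ 2 * C 1 0 - Real.sin θ * Real.cos θ * (C 0 0 + C 1 1) := by fun_prop
  have hmem : (0 : ℝ) ∈ Set.uIcc (Real.cos 0 ^ 2 * C 0 1
      + Real.sin 0 ^ 2 * C 1 0 - Real.sin 0 * Real.cos 0 * (C 0 0 + C 1 1))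
      (Real.cos (Real.pi / 2) ^ 2 * C 0 1 + Real.sin (Real.pi / 2) ^ 2 * C 1 0
        - Real.sin (Real.pi / 2) * Real.cos (Real.pi / 2) * (C 0 0 + C 1 1)) := by
    rw [Set.mem_uIcc]
    simp [hc0]
    exact (le_total _ _).symm
  obtain ⟨θ, -, h⟩ := intermediate_value_uIcc hcont.continuousOn hmem
  exact ⟨θ, h⟩

lemma eq_phaseRotation_comp_symplecticPart (h0 : 0 < η) (h1 : η ≤ 1) (θ : ℝ) {ω : LocalTGCP}
    (hωS : ω.alice.S = S) (hωT : ω.bob.S = T) (hG : ω.alice.G = 0)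
    (hG' : ω.bob.G = (1 - η ^ 2) • (1 : Mat2)) :
    ω = (LocalTGCP.phaseRotation θ).comp ((LocalTGCP.attenuateBob η ⟨h0.le, h1⟩).comp
      (LocalTGCP.symplecticPart S T η hS hT h0.ne' θ)) := by
  apply LocalTGCP.ext
  · apply TGCP.ext
    · change ω.alice.S = rotationMatrix (-θ) * (1 * (rotationMatrix θ * S))
      rw [hωS, Matrix.one_mul, ← Matrix.mul_assoc, rotationMatrix_neg_mul, Matrix.one_mul]
    · change ω.alice.G = rotationMatrix (-θ) * (1 * 0 * 1ᵀ + 0) * (rotationMatrix (-θ))ᵀ + 0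
      rw [hG]; simp
  · apply TGCP.ext
    · change ω.bob.S = rotationMatrix θ * ((η • (1 : Mat2)) * (rotationMatrix (-θ) * (η⁻¹ • T)))
      rw [hωT, Matrix.smul_mul, Matrix.one_mul, Matrix.mul_smul, Matrix.mul_smul, Matrix.mul_smul,
        smul_smul, mul_inv_cancel₀ h0.ne', one_smul, ← Matrix.mul_assoc, rotationMatrix_mul_neg,
        Matrix.one_mul]
    · change ω.bob.G = rotationMatrix θ * ((η • (1 : Mat2)) * 0 * (η • (1 : Mat2))ᵀ
        + (1 - η ^ 2) • (1 : Mat2)) * (rotationMatrix θ)ᵀ + 0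
      rw [hG', rotationMatrix_transpose, Matrix.mul_zero,
        Matrix.zero_mul, zero_add, add_zero, Matrix.mul_smul, Matrix.mul_one, Matrix.smul_mul,
        rotationMatrix_mul_neg]

end SymplecticPart

/-- With `η² = det T`, the pair `(S, η⁻¹ T)` is symplectic and moves the minimum to `(1, η)`. The
rotation that diagonalizes the correlations commutes with the scalar attenuation, so the final phase
rotation undoes it. -/
lemma IsOptimal.exists_normalForm_of_det_alice {V : Mat4} (hV : Uncertain V) (hI : Inseparable V)
    {ω : LocalTGCP} (hω : IsOptimal V ω) (ha : ω.alice.S.det = 1) (hb : 0 < ω.bob.S.det)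
    (hb1 : ω.bob.S.det ≤ 1) :
    ∃ (σ : LocalTGCP) (η n m d lam θ : ℝ) (h0 : 0 < η) (h1 : η ≤ 1), σ.IsSymplectic ∧
      (η < 1 → η = d / (m - 1)) ∧ IsNormalForm η n m d lam (σ.apply V) ∧
      ω = (LocalTGCP.phaseRotation θ).comp
        ((LocalTGCP.attenuateBob η ⟨h0.le, h1⟩).comp σ) := by
  obtain ⟨hG, hmin⟩ := (isOptimal_iff hV ω).1 hω
  obtain ⟨η, h0, h1, hη⟩ : ∃ η : ℝ, 0 < η ∧ η ≤ 1 ∧ ω.bob.S.det = η ^ 2 :=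
    ⟨√ω.bob.S.det, Real.sqrt_pos.2 hb, Real.sqrt_le_one.2 hb1, (Real.sq_sqrt hb.le).symm⟩
  have hsymp := LocalTGCP.isSymplectic_symplecticPart ha hη h0.ne'
  have hmin' : ∀ θ S T,
      cost ((LocalTGCP.symplecticPart _ _ η ha hη h0.ne' θ).apply V) 1 (η • (1 : Mat2))
        ≤ cost ((LocalTGCP.symplecticPart _ _ η ha hη h0.ne' θ).apply V) S T := by
    intro θ S T
    rw [cost_symplecticPart_apply, cost_apply (hsymp θ)]
    exact hmin _ _
  obtain ⟨θ, hθ⟩ := exists_symplecticPart_apply_eq_zero ha hη h0.ne' V fun θ => by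
    refine (stationary_of_minimal (hV.apply (hsymp θ)) h0 fun S T hS hT => ?_).1
    have := hmin' θ S T
    simp only [cost, hS, hT, det_one, det_smul, Fintype.card_fin, mul_one] at this
    linarith
  obtain ⟨n, m, d, lam, hN, hrel⟩ := isNormalForm_of_minimal (hV.apply (hsymp θ))
    (hI.apply (hsymp θ)) h0 h1 (hmin' θ) hθ
  refine ⟨_, η, n, m, d, lam, θ, h0, h1, hsymp θ, hrel, hN,
    eq_phaseRotation_comp_symplecticPart ha hη h0 h1 θ rfl rfl ?_ ?_⟩
  · rw [hG.alice, ha]; simp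
  · rw [hG.bob, hη, abs_of_nonneg (by nlinarith)]

/-- Every optimal map is canonical up to a phase rotation. -/
lemma IsOptimal.exists_isCanonical {V : Mat4} (hV : Uncertain V) (hI : Inseparable V)
    {ω : LocalTGCP} (hω : IsOptimal V ω) :
    ∃ (κ : LocalTGCP) (θ : ℝ), IsCanonical V κ ∧ ω = (LocalTGCP.phaseRotation θ).comp κ := by
  rcases det_of_minimal hV hI ((isOptimal_iff hV ω).1 hω).2 with ⟨h1, h2, h3⟩ | ⟨h1, h2, h3⟩
  · obtain ⟨σ, η, n, m, d, lam, θ, h0, h1, hs, hr, hn, he⟩ :=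
      hω.exists_normalForm_of_det_alice hV hI h1 h2 h3
    exact ⟨_, θ, ⟨σ, η, n, m, d, lam, h0, h1, hs, hr, Or.inl ⟨hn, rfl⟩⟩, he⟩
  · obtain ⟨σ, η, n, m, d, lam, θ, h0, h1, hs, hr, hn, he⟩ :=
      hω.swap.exists_normalForm_of_det_alice hV.swapModes hI.swapModes h1 h2 h3
    refine ⟨(LocalTGCP.attenuateAlice η ⟨h0.le, h1⟩).comp σ.swap, -θ,
      ⟨σ.swap, η, n, m, d, lam, h0, h1, hs.swap, hr, Or.inr ⟨?_, rfl⟩⟩, ?_⟩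
    · rw [← LocalTGCP.swap_apply_swapModes]; exact hn
    · have h := congrArg LocalTGCP.swap he
      refine Eq.trans h ?_
      simp only [LocalTGCP.swap, LocalTGCP.comp, LocalTGCP.phaseRotation, LocalTGCP.attenuateAlice,
        LocalTGCP.attenuateBob, neg_neg]

lemma Uncertain.halfTrace_one_pos {V : Mat4} (hV : Uncertain V) (T : Mat2) :
    0 < halfTrace V 1 T := by
  obtain ⟨c, hc, h⟩ := hV.exists_le_halfTrace
  refine lt_of_lt_of_le ?_ (h 1 T)
  have : 0 ≤ ∑ i, ∑ j, T i j ^ 2 := by positivity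
  have h1 : ∑ i, ∑ j, (1 : Mat2) i j ^ 2 = 2 := by
    simp [Fin.sum_univ_two]; norm_num
  rw [h1]
  positivity

/-- The relation says that Bob's multiplier is `1`. -/
lemma sub_div_eq_one_of_eq_div_sub_one {η m d : ℝ} (hη : 0 < η) (h : η = d / (m - 1)) : m - d / η = 1 := by
  have hm : m - 1 ≠ 0 := by
    intro h0
    rw [h0, div_zero] at h
    exact hη.ne' h
  rw [eq_div_iff hm] at h
  field_simp
  linarith

/-! ### Global optimality of an attenuation with `τ < 1` -/

section Relation

/-- The discriminant that makes the Lagrangian in the relation case positive definite. -/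
lemma discriminant_pos {α w κ κ' : ℝ} (hκ : 0 < κ) (hκ' : 0 < κ') (hw0 : 0 < w) (hw : w < 1)
    (hα : 0 < α + w) (h : (1 + κ) * (1 - α) ≤ 2 * w * κ) (h' : (1 + κ') * (1 - α) ≤ 2 * w * κ') :
    0 < α * (κ + κ') + κ * κ' * (α + w) := by
  wlog hle : κ ≤ κ' generalizing κ κ'
  · have := this hκ' hκ h' h (le_of_not_ge hle)
    linarith
  have hpos : 0 < κ * κ' * (α + w) := by positivity
  rcases le_or_gt 0 α with h0 | h0
  · have : 0 ≤ α * (κ + κ') := by positivity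
    linarith
  -- For `α ≤ 0` and `κ ≤ κ'`, it suffices that `α (2 + κ) + κ w > 0`. The hypothesis on `κ` bounds
  -- `1 + κ` times this from below by the present expression.
  have h1 : 0 < (1 + κ) * (2 + κ) - w * κ * (3 + κ) := by
    have : w * (κ * (3 + κ)) ≤ 1 * (κ * (3 + κ)) :=
      mul_le_mul_of_nonneg_right hw.le (by positivity)
    nlinarith
  have h2 : 0 < (1 + κ) * (α * (2 + κ) + κ * w) := by nlinarith
  have h3 : 0 < α * (2 + κ) + κ * w := (mul_pos_iff_of_pos_left (by positivity)).1 h2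
  have h4 : 0 < κ' * (α * (2 + κ) + κ * w) := by positivity
  have h5 : α * κ' ≤ α * κ := mul_le_mul_of_nonpos_left hle h0.le
  linarith

/-- `α` may be negative, so positivity has to come from the constraint: eliminating `b` and
completing squares leaves the discriminant as the coefficient of `a²`. -/
lemma quadratic_nonneg {α τ κ κ' : ℝ} (hκ : 0 < κ) (hκ' : 0 < κ')
    (hD : 0 < α * (κ + κ') + κ * κ' * (α + τ ^ 2)) {a b g h : ℝ} (hgh : g + h = τ * a - b) :
    0 ≤ α * a ^ 2 + b ^ 2 + κ' * g ^ 2 + κ * h ^ 2 ∧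
      (α * a ^ 2 + b ^ 2 + κ' * g ^ 2 + κ * h ^ 2 = 0 → a = 0 ∧ b = 0 ∧ g = 0 ∧ h = 0) := by
  set M := κ + κ' + κ * κ' with hM
  have hM0 : 0 < M := by positivity
  have hK : 0 < κ + κ' := by positivity
  have hb : b = τ * a - g - h := by linarith
  have key : (κ + κ') * M * (α * a ^ 2 + b ^ 2 + κ' * g ^ 2 + κ * h ^ 2)
      = (M * b - κ * κ' * τ * a) ^ 2
        + (κ + κ') * (α * (κ + κ') + κ * κ' * (α + τ ^ 2)) * a ^ 2
        + M * (κ' * g - κ * h) ^ 2 := by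
    rw [hM, hb]; ring
  have n1 := sq_nonneg (M * b - κ * κ' * τ * a)
  have n2 : 0 ≤ (κ + κ') * (α * (κ + κ') + κ * κ' * (α + τ ^ 2)) * a ^ 2 := by positivity
  have n3 : 0 ≤ M * (κ' * g - κ * h) ^ 2 := by positivity
  have hKM : 0 < (κ + κ') * M := by positivity
  refine ⟨?_, fun h0 => ?_⟩
  · by_contra! hneg
    nlinarith [mul_neg_of_pos_of_neg hKM hneg]
  · rw [h0, mul_zero] at key
    have z2 : (κ + κ') * (α * (κ + κ') + κ * κ' * (α + τ ^ 2)) * a ^ 2 = 0 := by linarith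
    have ha : a = 0 := by
      have := (mul_eq_zero.1 z2).resolve_left (by positivity)
      exact pow_eq_zero_iff two_ne_zero |>.1 this
    have z1 : (M * b - κ * κ' * τ * a) ^ 2 = 0 := by linarith
    have hb0 : b = 0 := by
      rw [ha, mul_zero, sub_zero] at z1
      exact (mul_eq_zero.1 (pow_eq_zero_iff two_ne_zero |>.1 z1)).resolve_left hM0.ne'
    have hg : h = -g := by rw [ha, hb0] at hgh; linarith
    rw [ha, hb0, hg] at h0
    have : (κ + κ') * g ^ 2 = 0 := by linarith
    have hg0 : g = 0 := pow_eq_zero_iff two_ne_zero |>.1 ((mul_eq_zero.1 this).resolve_left hK.ne')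
    exact ⟨ha, hb0, hg0, by rw [hg, hg0, neg_zero]⟩

variable {τ α d e : ℝ}

lemma Uncertain.le_of_criticalCM (hτ : 0 < τ)
    (hV : Uncertain (criticalCM τ α 1 d e)) (hd : 0 < d) (he : 0 < e) :
    (1 + d / τ) * (1 - α) ≤ 2 * τ ^ 2 * (d / τ) ∧
      (1 + e / τ) * (1 - α) ≤ 2 * τ ^ 2 * (e / τ) := by
  have hκ : 0 < d / τ := by positivity
  have hκ' : 0 < e / τ := by positivity
  constructor
  -- The test pair makes the squares weighted by `e` vanish, so only `κ = d / τ` enters; a factor `1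
  -- + κ` then cancels. The second pair does the same for `e`.
  · have h := hV.le_halfTrace !![1 + d / τ, 0; 0, -(1 + d / τ)]
      !![τ * (1 + d / τ), 0; 0, τ * (1 - d / τ)]
    rw [halfTrace_criticalCM hτ] at h
    generalize d / τ = κ at h hκ ⊢
    simp at h
    have : (1 + κ) * ((1 + κ) * (1 - α)) ≤ (1 + κ) * (2 * τ ^ 2 * κ) := by linarith
    exact le_of_mul_le_mul_left this (by positivity)
  · have h := hV.le_halfTrace !![1 + e / τ, 0; 0, -(1 + e / τ)]
      !![-(τ * (1 - e / τ)), 0; 0, -(τ * (1 + e / τ))]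
    rw [halfTrace_criticalCM hτ] at h
    generalize e / τ = κ at h hκ' ⊢
    simp at h
    have : (1 + κ) * ((1 + κ) * (1 - α)) ≤ (1 + κ) * (2 * τ ^ 2 * κ) := by linarith
    exact le_of_mul_le_mul_left this (by positivity)

/-- The squares split into a diagonal and an off-diagonal group, each covered by `quadratic_nonneg`.
Equality forces `T = τ Z S Z`. -/
lemma halfTrace_lower_bound (hτ : 0 < τ) (hτ1 : τ < 1)
    (hV : Uncertain (criticalCM τ α 1 d e)) (hd : 0 < d) (he : 0 < e) (S T : Mat2) :
    α * S.det + T.det ≤ halfTrace (criticalCM τ α 1 d e) S T ∧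
      (halfTrace (criticalCM τ α 1 d e) S T = α * S.det + T.det → T.det = τ ^ 2 * S.det) := by
  have hα : 0 < α + τ ^ 2 := by
    have := hV.halfTrace_one_pos (τ • 1)
    rwa [halfTrace_criticalCM_one hτ, mul_one] at this
  obtain ⟨h1, h2⟩ := hV.le_of_criticalCM hτ hd he
  have hκ : 0 < d / τ := by positivity
  have hκ' : 0 < e / τ := by positivity
  have hD := discriminant_pos hκ hκ' (by positivity : 0 < τ ^ 2) (by nlinarith) hα h1 h2
  obtain ⟨p1, q1⟩ := quadratic_nonneg hκ hκ' hD (a := S 0 0 - S 1 1) (b := T 0 0 - T 1 1)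
    (g := τ * S 0 0 - T 0 0) (h := -(τ * S 1 1 - T 1 1)) (by ring)
  obtain ⟨p2, q2⟩ := quadratic_nonneg hκ hκ' hD (a := S 0 1 + S 1 0) (b := -(T 0 1 + T 1 0))
    (g := τ * S 1 0 + T 1 0) (h := τ * S 0 1 + T 0 1) (by ring)
  rw [halfTrace_criticalCM hτ]
  rw [neg_sq] at p1 p2 q1 q2
  constructor
  · linarith
  · intro h0
    obtain ⟨a1, b1, g1, h1⟩ := q1 (by linarith)
    obtain ⟨a2, b2, g2, h2⟩ := q2 (by linarith)
    have t0 : T 0 0 = τ * S 0 0 := by linarith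
    have t1 : T 1 1 = τ * S 1 1 := by linarith
    have t2 : T 1 0 = -(τ * S 1 0) := by linarith
    have t3 : T 0 1 = -(τ * S 0 1) := by linarith
    rw [det_fin_two, det_fin_two, t0, t1, t2, t3]; ring

lemma Inseparable.lt_one_of_criticalCM (hτ : 0 < τ) (hτ1 : τ < 1)
    (hV : Uncertain (criticalCM τ α 1 d e)) (hI : Inseparable (criticalCM τ α 1 d e))
    (hd : 0 < d) (he : 0 < e) : α < 1 := by
  by_contra! hα
  obtain ⟨S, T, h⟩ := hI
  have h1 := (halfTrace_lower_bound hτ hτ1 hV hd he S T).1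
  have h2 := hV.le_halfTrace S T
  rcases le_total 0 S.det with hS | hS
  · nlinarith
  · linarith

/-- Both sides compare with `1 + α`: as `-1 < α < 1`, one has `|1 - det S| + α det S ≥ α`, and `|1 -
det T| + det T ≥ 1`. Equality in the half trace bound needs `det T = τ² det S`, impossible for two
determinants one. -/
lemma cost_lower_bound (hτ : 0 < τ) (hτ1 : τ < 1)
    (hV : Uncertain (criticalCM τ α 1 d e)) (hI : Inseparable (criticalCM τ α 1 d e))
    (hd : 0 < d) (he : 0 < e) (S T : Mat2) :
    cost (criticalCM τ α 1 d e) 1 (τ • (1 : Mat2)) ≤ cost (criticalCM τ α 1 d e) S T ∧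
      (S.det = 1 → T.det = 1 →
        cost (criticalCM τ α 1 d e) 1 (τ • (1 : Mat2)) < cost (criticalCM τ α 1 d e) S T) := by
  have hα : 0 < α + τ ^ 2 := by
    have := hV.halfTrace_one_pos (τ • 1)
    rwa [halfTrace_criticalCM_one hτ, mul_one] at this
  have hα1 := hI.lt_one_of_criticalCM hτ hτ1 hV hd he
  have hτ2 : τ ^ 2 < 1 := by nlinarith
  have hc : cost (criticalCM τ α 1 d e) 1 (τ • (1 : Mat2)) = 1 + α := by
    rw [cost, halfTrace_criticalCM_one hτ, det_one, det_smul, det_one, sub_self, abs_zero,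
      Fintype.card_fin, mul_one, abs_of_pos (by linarith)]
    ring
  obtain ⟨h1, h2⟩ := halfTrace_lower_bound hτ hτ1 hV hd he S T
  have ha : α ≤ |1 - S.det| + α * S.det := by
    rcases le_total 0 (1 - S.det) with h | h
    · rw [abs_of_nonneg h]; nlinarith
    · rw [abs_of_nonpos h]; nlinarith
  have hb : 1 ≤ |1 - T.det| + T.det := by linarith [le_abs_self (1 - T.det)]
  rw [hc]
  refine ⟨by rw [cost]; linarith, fun hS hT => ?_⟩
  rw [hS, hT] at h1 h2
  have : halfTrace (criticalCM τ α 1 d e) S T ≠ α * 1 + 1 := fun h => by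
    have := h2 h; linarith
  have := lt_of_le_of_ne h1 this.symm
  rw [cost, hS, hT]; simp; linarith

end Relation

/-! ### The cost of a normal form `V_1` is a local symplectic invariant -/

section Uniqueness

/-- The two stationarity conditions are incompatible for squeezings with `1 < x < y`. -/
lemma no_critical_squeezing {α h d e x y : ℝ} (hd : 0 < d) (he : 0 < e) (hα : 0 < α) (hh : 0 < h)
    (hdα : 2 * (α * h) < d * (α - h)) (heα : 2 * (α * h) < e * (α - h)) (hx : 1 < x) (hxy : x < y)
    (h1 : α * y * (x ^ 4 - 1) = (y - x) * (e * x ^ 3 * y + d))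
    (h2 : h * x * (y ^ 4 - 1) = (y - x) * (e * x * y ^ 3 + d)) : False := by
  have hx0 : 0 < x := by linarith
  have hy0 : 0 < y := by linarith
  set s := x * y with hs
  have hs1 : 1 < s := by nlinarith
  set q := x ^ 2 + x * y + y ^ 2 with hq
  have hqs : 3 * s ≤ q := by nlinarith [sq_nonneg (x - y)]
  set P := (e * x * y ^ 3 + d) * (e * x ^ 3 * y + d) with hP
  set R := e * (s ^ 4 + s * q) + d * (s * q + 1) with hR
  have hP0 : 0 < P := by positivity
  have hk : 0 < y - x := by linarith
  -- Cross-multiplying the two conditions leaves a common factor `y - x` and the identity `(α - h) P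
  -- = α h R`. It contradicts the bounds on `d` and `e` as soon as `m R ≤ 2 P` for `m = d` or `m =
  -- e`; the smaller of the two works.
  have key : (y - x) * ((α - h) * P) = (y - x) * (α * h * R) := by
    rw [hP, hR, hq, hs]
    linear_combination -α * (e * x ^ 3 * y + d) * h2
      + h * (e * x * y ^ 3 + d) * h1
  have key := mul_left_cancel₀ hk.ne' key
  have hPe : P = e ^ 2 * s ^ 4 + e * d * s * (q - s) + d ^ 2 := by
    rw [hP, hq, hs]; ring
  have hαh : 0 < α * h := by positivity
  have bound : ∀ m, 2 * (α * h) < m * (α - h) → m * R ≤ 2 * P → False := by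
    intro m hm hmR
    have e1 : 2 * (α * h) * P < m * (α - h) * P := mul_lt_mul_of_pos_right hm hP0
    have e2 : m * (α - h) * P = (α * h) * (m * R) := by linear_combination m * key
    have e3 : (α * h) * (m * R) ≤ (α * h) * (2 * P) := mul_le_mul_of_nonneg_left hmR hαh.le
    linarith
  rcases le_total e d with hed | hed
  · refine bound e heα ?_
    obtain ⟨f, rfl⟩ : ∃ f, d = e + f := ⟨d - e, by ring⟩
    have hf : 0 ≤ f := by linarith
    have : 2 * P - e * R = e ^ 2 * (s ^ 2 - 1) ^ 2 + e * f * s ^ 2 + 3 * e * f + 2 * f ^ 2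
        + e * f * s * (q - 3 * s) := by
      rw [hPe, hR]; ring
    have : 0 ≤ e * f * s * (q - 3 * s) := mul_nonneg (by positivity) (by linarith)
    have : 0 ≤ e ^ 2 * (s ^ 2 - 1) ^ 2 + e * f * s ^ 2 + 3 * e * f + 2 * f ^ 2 := by positivity
    linarith
  · refine bound d hdα ?_
    have i1 : (e + d) * P - e * (d * R) = (e * s ^ 2 - d) * (e ^ 2 * s ^ 2 - d ^ 2) := by
      rw [hPe, hR]; ring
    have hs2 : 1 < s ^ 2 := by nlinarith
    have i2 : 0 ≤ e * s ^ 2 - d := by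
      have : 0 ≤ e * (s ^ 2 - 1) := mul_nonneg he.le (by linarith)
      linarith
    have i3 : 0 ≤ e ^ 2 * s ^ 2 - d ^ 2 := by
      have : d ^ 2 ≤ e ^ 2 := by nlinarith
      have : 0 ≤ e ^ 2 * (s ^ 2 - 1) := mul_nonneg (sq_nonneg e) (by linarith)
      linarith
    have i4 : 0 ≤ (e * s ^ 2 - d) * (e ^ 2 * s ^ 2 - d ^ 2) := mul_nonneg i2 i3
    have i5 : (e + d) * P ≤ (2 * e) * P := mul_le_mul_of_nonneg_right (by linarith) hP0.le
    have i6 : e * (d * R) ≤ e * (2 * P) := by linarith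
    exact le_of_mul_le_mul_left i6 he

/-- The conditions force `x > 1` if `x < y`, and `x < 1` if `y < x`. Replacing `x`, `y` by their
inverses exchanges `d` and `e` and reduces the second case to the first. -/
lemma critical_squeezing_trivial_of_neg {α h d e x y : ℝ} (hd : 0 < d) (he : 0 < e) (hα : 0 < α)
    (hh : 0 < h) (hdα : 2 * (α * h) < d * (α - h)) (heα : 2 * (α * h) < e * (α - h))
    (hx : 0 < x) (hy : 0 < y)
    (h1 : α * y * (x ^ 4 - 1) = (y - x) * (e * x ^ 3 * y + d))
    (h2 : h * x * (y ^ 4 - 1) = (y - x) * (e * x * y ^ 3 + d)) : x = 1 ∧ y = 1 := by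
  have hpow : ∀ z : ℝ, 0 < z → 0 < z ^ 4 - 1 → 1 < z := by
    intro z hz h
    by_contra! hle
    have := pow_le_one₀ (n := 4) hz.le hle
    linarith
  rcases lt_trichotomy x y with hxy | hxy | hxy
  · exfalso
    have : 0 < α * y * (x ^ 4 - 1) := by
      rw [h1]; exact mul_pos (by linarith) (by positivity)
    exact no_critical_squeezing hd he hα hh hdα heα
      (hpow x hx ((mul_pos_iff_of_pos_left (by positivity)).1 this)) hxy h1 h2
  · subst hxy
    rw [sub_self, zero_mul] at h1
    have h3 : x ^ 4 - 1 = 0 := (mul_eq_zero.1 h1).resolve_left (by positivity)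
    have h4 : x = 1 := (pow_eq_one_iff_of_nonneg hx.le (by norm_num)).1 (by linarith : x ^ 4 = 1)
    exact ⟨h4, h4⟩
  · exfalso
    have hneg : α * y * (x ^ 4 - 1) < 0 := by
      rw [h1]; exact mul_neg_of_neg_of_pos (by linarith) (by positivity)
    have hx1 : x < 1 := by
      by_contra! hle
      have := one_le_pow₀ (n := 4) hle
      have : 0 ≤ α * y * (x ^ 4 - 1) := mul_nonneg (by positivity) (by linarith)
      linarith
    refine no_critical_squeezing (x := x⁻¹) (y := y⁻¹) he hd hα hh heα hdα
      ((one_lt_inv₀ hx).2 hx1) ((inv_lt_inv₀ hx hy).2 hxy) ?_ ?_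
    · field_simp
      linear_combination -h1
    · field_simp
      linear_combination -h2

lemma critical_squeezing_trivial_of_nonneg {α β d e x y : ℝ} (hd : 0 < d) (he : 0 < e)
    (hα : 0 ≤ α) (hβ : 0 ≤ β) (hν : 0 < α + β) (hx : 0 < x) (hy : 0 < y)
    (h1 : α * y * (x ^ 4 - 1) = (y - x) * (e * x ^ 3 * y + d))
    (h2 : β * x * (y ^ 4 - 1) = (x - y) * (e * x * y ^ 3 + d)) : x = 1 ∧ y = 1 := by
  have hlt : ∀ {z c : ℝ}, 0 < z → 0 ≤ c → 0 < c * (z ^ 4 - 1) → 1 < z := by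
    intro z c hz hc h
    by_contra! hle
    have := pow_le_one₀ (n := 4) hz.le hle
    nlinarith
  have hgt : ∀ {z c : ℝ}, 0 < z → 0 ≤ c → c * (z ^ 4 - 1) < 0 → z < 1 := by
    intro z c hz hc h
    by_contra! hle
    have := one_le_pow₀ (n := 4) hle
    nlinarith
  have hα' : 0 ≤ α * y := by positivity
  have hβ' : 0 ≤ β * x := by positivity
  rcases lt_trichotomy x y with hxy | hxy | hxy
  · exfalso
    have a := hlt hx hα' (by rw [h1]; exact mul_pos (by linarith) (by positivity))
    have b := hgt hy hβ' (by rw [h2]; exact mul_neg_of_neg_of_pos (by linarith) (by positivity))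
    linarith
  · subst hxy
    have h3 : ((α + β) * x) * (x ^ 4 - 1) = 0 := by linear_combination h1 + h2
    have h4 := (mul_eq_zero.1 h3).resolve_left (by positivity)
    have h5 : x = 1 := (pow_eq_one_iff_of_nonneg hx.le (by norm_num)).1 (by linarith : x ^ 4 = 1)
    exact ⟨h5, h5⟩
  · exfalso
    have a := hgt hx hα' (by rw [h1]; exact mul_neg_of_neg_of_pos (by linarith) (by positivity))
    have b := hlt hy hβ' (by rw [h2]; exact mul_pos (by linarith) (by positivity))
    linarith

/-- As `α + β > 0`, at most one multiplier is negative. In that case `α β > -1`, so `1 - α β > -2 α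
β`, which turns the lower bounds on `d` and `e` into the strict ones needed. -/
lemma critical_squeezing_trivial {α β d e x y : ℝ} (hd : 0 < d) (he : 0 < e)
    (hα : α ≤ 1) (hβ : β ≤ 1) (hν : 0 < α + β)
    (hdν : 1 ≤ α * β + d * (α + β)) (heν : 1 ≤ α * β + e * (α + β)) (hx : 0 < x) (hy : 0 < y)
    (h1 : α * y * (x ^ 4 - 1) = (y - x) * (e * x ^ 3 * y + d))
    (h2 : β * x * (y ^ 4 - 1) = (x - y) * (e * x * y ^ 3 + d)) : x = 1 ∧ y = 1 := by
  rcases lt_or_ge α 0 with hα0 | hα0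
  · have hb : β ^ 2 ≤ 1 := by nlinarith
    have hc : 0 < β * (α + β) := mul_pos (by linarith) hν
    have := critical_squeezing_trivial_of_neg (α := β) (h := -α) (x := y) (y := x) hd he
      (by linarith) (by linarith) (by nlinarith) (by nlinarith) hy hx
      (by linear_combination h2) (by linear_combination -h1)
    exact this.symm
  rcases lt_or_ge β 0 with hβ0 | hβ0
  · have hb : α ^ 2 ≤ 1 := by nlinarith
    have hc : 0 < α * (α + β) := mul_pos (by linarith) hν
    exact critical_squeezing_trivial_of_neg (α := α) (h := -β) hd he
      (by linarith) (by linarith) (by nlinarith) (by nlinarith) hx hy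
      h1 (by linear_combination -h2)
  · exact critical_squeezing_trivial_of_nonneg hd he hα0 hβ0 hν hx hy h1 h2

/-- The invariants make the second form a squeezing of the first by `diag(x, 1/x)` and `diag(y,
1/y)`. That both are of type `V_1` gives the two equations for `x` and `y`. -/
lemma multipliers_sum_eq_of_invariants_aux {α β d e α' β' d' e' : ℝ}
    (hd : 0 < d) (he : 0 < e) (hα : α ≤ 1) (hβ : β ≤ 1) (hν : 0 < α + β)
    (hdν : 1 ≤ α * β + d * (α + β)) (heν : 1 ≤ α * β + e * (α + β))
    (hn1 : 0 < α + e) (hm1 : 0 < β + e) (hd' : 0 < d')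
    (hn1' : 0 < α' + e') (hm1' : 0 < β' + e')
    (iA : (α' + e') * (α' + d') = (α + e) * (α + d))
    (iB : (β' + e') * (β' + d') = (β + e) * (β + d)) (iC : d' * e' = d * e)
    (iP : (α' + e') * (β' + e') * d' ^ 2 = (α + e) * (β + e) * d ^ 2) :
    α' + β' = α + β := by
  set x := √((α' + e') / (α + e)) with hx
  set y := √((β' + e') / (β + e)) with hy
  have hx0 : 0 < x := Real.sqrt_pos.2 (by positivity)
  have hy0 : 0 < y := Real.sqrt_pos.2 (by positivity)
  have hx2 : α' + e' = x ^ 2 * (α + e) := by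
    rw [hx, Real.sq_sqrt (by positivity)]; field_simp
  have hy2 : β' + e' = y ^ 2 * (β + e) := by
    rw [hy, Real.sq_sqrt (by positivity)]; field_simp
  have hx3 : x ^ 2 * (α' + d') = α + d := by
    rw [hx2] at iA
    have : (α + e) * (x ^ 2 * (α' + d')) = (α + e) * (α + d) := by linarith
    exact mul_left_cancel₀ hn1.ne' this
  have hy3 : y ^ 2 * (β' + d') = β + d := by
    rw [hy2] at iB
    have : (β + e) * (y ^ 2 * (β' + d')) = (β + e) * (β + d) := by linarith
    exact mul_left_cancel₀ hm1.ne' this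
  have hs : (x * y * d') ^ 2 = d ^ 2 := by
    rw [hx2, hy2] at iP
    have : ((α + e) * (β + e)) * (x * y * d') ^ 2 = ((α + e) * (β + e)) * d ^ 2 := by linarith
    exact mul_left_cancel₀ (by positivity) this
  have hs' : x * y * d' = d := (pow_left_inj₀ (by positivity) hd.le two_ne_zero).1 hs
  have he2 : e' = x * y * e := by
    have : d' * e' = d' * (x * y * e) := by rw [iC, ← hs']; ring
    exact mul_left_cancel₀ hd'.ne' this
  have h1 : α * y * (x ^ 4 - 1) = (y - x) * (e * x ^ 3 * y + d) := by
    linear_combination (-x ^ 2 * y) * hx2 + y * hx3 - x * hs' + x ^ 2 * y * he2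
  have h2 : β * x * (y ^ 4 - 1) = (x - y) * (e * x * y ^ 3 + d) := by
    linear_combination (-y ^ 2 * x) * hy2 + x * hy3 - y * hs' + y ^ 2 * x * he2
  obtain ⟨hx1, hy1⟩ := critical_squeezing_trivial hd he hα hβ hν hdν heν hx0 hy0 h1 h2
  rw [hx1, hy1] at he2
  rw [hx1] at hx2
  rw [hy1] at hy2
  linarith

/-- The sum of the multipliers is determined by the local symplectic invariants. -/
lemma multipliers_sum_eq_of_invariants {α β d e α' β' d' e' : ℝ}
    (hd : 0 < d) (he : 0 < e) (hα : α ≤ 1) (hβ : β ≤ 1) (hν : 0 < α + β)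
    (hdν : 1 ≤ α * β + d * (α + β)) (heν : 1 ≤ α * β + e * (α + β))
    (hn1 : 0 < α + e) (hm1 : 0 < β + e) (hd' : 0 < d') (he' : 0 < e')
    (hn1' : 0 < α' + e') (hn2' : 0 < α' + d') (hm1' : 0 < β' + e') (hm2' : 0 < β' + d')
    (iA : (α' + e') * (α' + d') = (α + e) * (α + d))
    (iB : (β' + e') * (β' + d') = (β + e) * (β + d)) (iC : d' * e' = d * e)
    (iD : (α' + e') * (β' + e') * d' ^ 2 + (α' + d') * (β' + d') * e' ^ 2
      = (α + e) * (β + e) * d ^ 2 + (α + d) * (β + d) * e ^ 2) :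
    α' + β' = α + β := by
  have hprod : ((α' + e') * (β' + e') * d' ^ 2) * ((α' + d') * (β' + d') * e' ^ 2)
      = ((α + e) * (β + e) * d ^ 2) * ((α + d) * (β + d) * e ^ 2) := by
    calc _ = ((α' + e') * (α' + d')) * ((β' + e') * (β' + d')) * (d' * e') ^ 2 := by ring
      _ = _ := by rw [iA, iB, iC]; ring
  set P := (α + e) * (β + e) * d ^ 2
  set Q := (α + d) * (β + d) * e ^ 2
  set P' := (α' + e') * (β' + e') * d' ^ 2 with hP'
  set Q' := (α' + d') * (β' + d') * e' ^ 2 with hQ'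
  -- `P'`, `Q'` have the same sum and product as `P`, `Q`. If `P' = Q`, position and momentum are
  -- exchanged, that is, `d'` and `e'`.
  have h : (P' - P) * (P' - Q) = 0 := by
    linear_combination P' * iD - hprod
  rcases mul_eq_zero.1 h with h | h
  · exact multipliers_sum_eq_of_invariants_aux hd he hα hβ hν hdν heν hn1 hm1 hd'
      hn1' hm1' iA iB iC (by linarith)
  · exact multipliers_sum_eq_of_invariants_aux hd he hα hβ hν hdν heν hn1 hm1 he'
      hn2' hm2' (by linarith) (by linarith) (by linarith) (by linarith)

/-- Dividing by `1 - r` and letting `r → 1` leaves `2 (1 - β) ≥ 0`. -/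
lemma le_one_of_one_sided {β c : ℝ} (hc : 0 < c)
    (h : ∀ r : ℝ, 0 ≤ r → r < 1 → 0 ≤ (1 - r ^ 2) * (1 - β) + c * (1 - r) ^ 2) : β ≤ 1 := by
  by_contra! hβ
  set ε := min 1 ((β - 1) / (2 * c)) with hε
  have hε0 : 0 < ε := lt_min one_pos (by apply div_pos <;> linarith)
  have hε1 : ε ≤ 1 := min_le_left _ _
  have hε2 : c * ε ≤ (β - 1) / 2 := by
    have : ε ≤ (β - 1) / (2 * c) := min_le_right _ _
    rw [le_div_iff₀ (by positivity)] at this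
    linarith
  have := h (1 - ε) (by linarith) (by linarith)
  have e1 : (1 - (1 - ε) ^ 2) * (1 - β) + c * (1 - (1 - ε)) ^ 2
      = ε * ((2 - ε) * (1 - β) + c * ε) := by ring
  rw [e1] at this
  have : (2 - ε) * (1 - β) + c * ε < 0 := by nlinarith
  nlinarith

lemma transpose_mul_J_mul (S : Mat2) : Sᵀ * J * S = S.det • J := by
  have := mul_J_mul_transpose Sᵀ
  rwa [transpose_transpose, det_transpose] at this

/-- The invariant of a two-mode correlation matrix under local symplectic maps that involves all
blocks. -/
noncomputable def mixedInvariant (V : Mat4) : ℝ :=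
  (V.toBlocks₁₁ * J * V.toBlocks₁₂ * J * V.toBlocks₂₂ * J * V.toBlocks₂₁ * J).trace

lemma mixedInvariant_apply {σ : LocalTGCP} (hσ : σ.IsSymplectic) (V : Mat4) :
    mixedInvariant (σ.apply V) = mixedInvariant V := by
  have ha : ∀ M : Mat2, σ.alice.Sᵀ * (J * (σ.alice.S * M)) = J * M := fun M => by
    have h := transpose_mul_J_mul σ.alice.S
    rw [hσ.det_alice, one_smul] at h
    rw [← Matrix.mul_assoc J, ← Matrix.mul_assoc, ← Matrix.mul_assoc, h]
  have hb : ∀ M : Mat2, σ.bob.Sᵀ * (J * (σ.bob.S * M)) = J * M := fun M => by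
    have h := transpose_mul_J_mul σ.bob.S
    rw [hσ.det_bob, one_smul] at h
    rw [← Matrix.mul_assoc J, ← Matrix.mul_assoc, ← Matrix.mul_assoc, h]
  have ha' : σ.alice.Sᵀ * (J * σ.alice.S) = J := by simpa using ha 1
  rw [mixedInvariant, LocalTGCP.apply_eq, hσ.1.2, hσ.2.2]
  simp only [toBlocks_fromBlocks₁₁, toBlocks_fromBlocks₁₂, toBlocks_fromBlocks₂₁,
    toBlocks_fromBlocks₂₂, add_zero, Matrix.mul_assoc, ha, hb]
  rw [trace_mul_comm]
  simp only [Matrix.mul_assoc, ha', mixedInvariant]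

lemma criticalCM_one_invariants {σ : LocalTGCP} (hσ : σ.IsSymplectic) {V : Mat4}
    {α β d e : ℝ} (h : σ.apply V = criticalCM 1 α β d e) :
    (α + e) * (α + d) = V.toBlocks₁₁.det ∧ (β + e) * (β + d) = V.toBlocks₂₂.det ∧
      d * e = - V.toBlocks₁₂.det ∧
      (α + e) * (β + e) * d ^ 2 + (α + d) * (β + d) * e ^ 2 = mixedInvariant V := by
  have hi := mixedInvariant_apply hσ V
  rw [h] at hi
  rw [LocalTGCP.apply_eq, hσ.1.2, hσ.2.2, criticalCM, fromBlocks_inj] at h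
  obtain ⟨hA, hC, -, hB⟩ := h
  rw [add_zero] at hA hB
  have dA := congrArg det hA
  have dB := congrArg det hB
  have dC := congrArg det hC
  simp only [det_mul, det_transpose, hσ.det_alice, hσ.det_bob, one_mul, mul_one,
    det_fin_two_of] at dA dB dC
  refine ⟨?_, ?_, ?_, ?_⟩
  · rw [dA]; ring
  · rw [dB]; ring
  · rw [dC]; ring
  · rw [← hi]
    simp [mixedInvariant, criticalCM, J, trace_fin_two]
    ring

/-- Scaling one mode by `r < 1` must not lower the cost, hence `α, β ≤ 1`. The last two bounds say
that the momentum and position blocks, of determinants `α β + d (α + β)` and `α β + e (α + β)`, have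
determinant at least `1`; they are uncertainty tested on diagonal matrices. -/
lemma multiplier_bounds_of_minimal {α β d e : ℝ} (hd : 0 < d) (he : 0 < e)
    (hV : Uncertain (criticalCM 1 α β d e))
    (hmin : ∀ S T, cost (criticalCM 1 α β d e) 1 1 ≤ cost (criticalCM 1 α β d e) S T) :
    α ≤ 1 ∧ β ≤ 1 ∧ 0 < α + β ∧ 1 ≤ α * β + d * (α + β) ∧ 1 ≤ α * β + e * (α + β) := by
  have h11 : halfTrace (criticalCM 1 α β d e) 1 1 = α + β := by
    have := halfTrace_criticalCM_one one_pos α β d e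
    simpa using this
  have hν : 0 < α + β := by
    rw [← h11]; exact hV.halfTrace_one_pos 1
  have hcost : cost (criticalCM 1 α β d e) 1 1 = α + β := by
    rw [cost, h11]; simp
  refine ⟨?_, ?_, hν, ?_, ?_⟩
  · refine le_one_of_one_sided (c := (d + e) / 2) (by positivity) fun r hr0 hr => ?_
    have h := hmin (r • 1) 1
    have hr2 : (0 : ℝ) ≤ 1 - r ^ 2 := by nlinarith
    rw [hcost, cost, halfTrace_criticalCM one_pos, det_smul, det_one, sub_self, abs_zero,
      Fintype.card_fin, mul_one, abs_of_nonneg hr2] at h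
    simp at h
    linarith
  · refine le_one_of_one_sided (c := (d + e) / 2) (by positivity) fun r hr0 hr => ?_
    have h := hmin 1 (r • 1)
    have hr2 : (0 : ℝ) ≤ 1 - r ^ 2 := by nlinarith
    rw [hcost, cost, halfTrace_criticalCM one_pos, det_smul, det_one, sub_self, abs_zero,
      Fintype.card_fin, mul_one, abs_of_nonneg hr2] at h
    simp at h
    linarith
  · have h := hV.le_halfTrace !![1, 0; 0, -β] !![1, 0; 0, α]
    rw [halfTrace_criticalCM one_pos] at h
    simp at h
    have : (α + β) * 1 ≤ (α + β) * (α * β + d * (α + β)) := by linarith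
    exact le_of_mul_le_mul_left this hν
  · have h := hV.le_halfTrace !![β, 0; 0, -1] !![-α, 0; 0, -1]
    rw [halfTrace_criticalCM one_pos] at h
    simp at h
    have : (α + β) * 1 ≤ (α + β) * (α * β + e * (α + β)) := by linarith
    exact le_of_mul_le_mul_left this hν

end Uniqueness

/-! ### From minima of the cost to optimal maps -/

lemma cost_le_of_cost_apply_le {V : Mat4} {σ : LocalTGCP} (hσ : σ.IsSymplectic) {S T : Mat2}
    (hmin : ∀ S' T', cost (σ.apply V) S T ≤ cost (σ.apply V) S' T') (S' T' : Mat2) :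
    cost V (S * σ.alice.S) (T * σ.bob.S) ≤ cost V S' T' := by
  have h := hmin (S' * σ.alice.S⁻¹) (T' * σ.bob.S⁻¹)
  rwa [cost_apply hσ, cost_apply hσ, mul_inv_mul_of_det_one hσ.det_alice,
    mul_inv_mul_of_det_one hσ.det_bob] at h

lemma isOptimal_attenuateBob_comp {V : Mat4} (hV : Uncertain V) {σ : LocalTGCP}
    (hσ : σ.IsSymplectic) {η ν : ℝ} (h0 : 0 < η) (h1 : η ≤ 1)
    (hN : bareNoise (σ.apply V) 1 (η • (1 : Mat2)) = ν • (1 : Mat2))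
    (hmin : ∀ S T, cost (σ.apply V) 1 (η • (1 : Mat2)) ≤ cost (σ.apply V) S T) :
    IsOptimal V ((LocalTGCP.attenuateBob η ⟨h0.le, h1⟩).comp σ) := by
  refine (isOptimal_iff hV _).2 ⟨⟨?_, ?_, ?_⟩, cost_le_of_cost_apply_le hσ hmin⟩
  · change (1 : Mat2) * σ.alice.G * 1ᵀ + 0 = |1 - ((1 : Mat2) * σ.alice.S).det| • 1
    rw [hσ.1.2, det_mul, hσ.det_alice]; simp
  · change (η • (1 : Mat2)) * σ.bob.G * (η • (1 : Mat2))ᵀ + (1 - η ^ 2) • (1 : Mat2)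
      = |1 - ((η • (1 : Mat2)) * σ.bob.S).det| • 1
    rw [hσ.2.2, det_mul, hσ.det_bob, det_smul, det_one, mul_one, mul_one, Fintype.card_fin,
      abs_of_nonneg (by nlinarith)]
    simp
  · change bareNoise V ((1 : Mat2) * σ.alice.S) ((η • (1 : Mat2)) * σ.bob.S)
      = halfTrace V ((1 : Mat2) * σ.alice.S) ((η • (1 : Mat2)) * σ.bob.S) • 1
    rw [halfTrace, ← bareNoise_apply σ hσ, hN]
    simp

lemma attenuateBob_one_comp (σ : LocalTGCP) (h : (1 : ℝ) ∈ Set.Icc (0 : ℝ) 1) :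
    (LocalTGCP.attenuateBob 1 h).comp σ = σ := by
  apply LocalTGCP.ext <;> apply TGCP.ext <;>
    simp [LocalTGCP.comp, LocalTGCP.attenuateBob, TGCP.comp, TGCP.attenuation, TGCP.id,
      TGCP.ofSymplectic]

lemma attenuateAlice_one_comp (σ : LocalTGCP) (h : (1 : ℝ) ∈ Set.Icc (0 : ℝ) 1) :
    (LocalTGCP.attenuateAlice 1 h).comp σ = σ :=
  congrArg LocalTGCP.swap (attenuateBob_one_comp σ.swap h)

/-- A solution of the relation with `τ < 1` yields an optimal map with attenuation, and excludes
optimal local symplectic maps. -/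
lemma SolvesRelation.isOptimal {V : Mat4} (hV : Uncertain V) (hI : Inseparable V) {τ : ℝ}
    (h0 : 0 < τ) (h1 : τ < 1) {σ : LocalTGCP} (h : SolvesRelation V τ σ) :
    IsOptimal V ((LocalTGCP.attenuateBob τ ⟨h0.le, h1.le⟩).comp σ) ∧
      ∀ ρ : LocalTGCP, ρ.IsSymplectic → ¬ IsOptimal V ρ := by
  obtain ⟨hσ, n, m, d, lam, hN, hrel⟩ := h
  have heq := hN.eq_criticalCM h0
  rw [sub_div_eq_one_of_eq_div_sub_one h0 hrel] at heq
  have hV' := hV.apply hσ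
  have hI' := hI.apply hσ
  have hmin := cost_lower_bound h0 h1 (heq ▸ hV') (heq ▸ hI') hN.d2_pos hN.d1_pos
  rw [← heq] at hmin
  constructor
  · refine isOptimal_attenuateBob_comp hV hσ (ν := n - τ * d + τ ^ 2 * 1) h0 h1.le ?_
      fun S T => (hmin S T).1
    rw [heq, bareNoise_criticalCM h0]
  · intro ρ hρ hopt
    have hle := ((isOptimal_iff hV ρ).1 hopt).2 (1 * σ.alice.S) ((τ • 1) * σ.bob.S)
    have hlt := (hmin (ρ.alice.S * σ.alice.S⁻¹) (ρ.bob.S * σ.bob.S⁻¹)).2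
      (by simp [det_mul, det_nonsing_inv, hσ.det_alice, hρ.det_alice])
      (by simp [det_mul, det_nonsing_inv, hσ.det_bob, hρ.det_bob])
    rw [cost_apply hσ, cost_apply hσ, mul_inv_mul_of_det_one hσ.det_alice,
      mul_inv_mul_of_det_one hσ.det_bob] at hlt
    linarith

lemma SolvesRelationSwapped.swap {V : Mat4} {τ : ℝ} {σ : LocalTGCP}
    (h : SolvesRelationSwapped V τ σ) : SolvesRelation (swapModes V) τ σ.swap :=
  ⟨h.1.swap, by rw [LocalTGCP.swap_apply_swapModes]; exact h.2⟩

lemma IsNormalForm.of_swapModes {n m d lam : ℝ} {V : Mat4}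
    (h : IsNormalForm 1 n m d lam (swapModes V)) : IsNormalForm 1 m n d lam V where
  n1_pos := by simpa using h.m1_pos
  n2_pos := h.m2_pos
  m1_pos := by simpa using h.n1_pos
  m2_pos := h.n2_pos
  d1_pos := h.d1_pos
  d2_pos := h.d2_pos
  eq := by
    rw [← swapModes_swapModes V, h.eq]
    ext (i | i) (j | j) <;> simp [swapModes]

/-- Without a solution of the relation, canonical maps do not attenuate. -/
lemma IsCanonical.reachesV1 {V : Mat4} {κ : LocalTGCP} (hκ : IsCanonical V κ)
    (hno : ∀ (τ : ℝ) (σ : LocalTGCP), 0 < τ → τ < 1 →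
      ¬ SolvesRelation V τ σ ∧ ¬ SolvesRelationSwapped V τ σ) : ReachesV1 V κ := by
  obtain ⟨σ, η, n, m, d, lam, h0, h1, hσ, hrel, h | h⟩ := hκ
  · obtain ⟨hN, rfl⟩ := h
    rcases h1.lt_or_eq with hlt | rfl
    · exact absurd ⟨hσ, n, m, d, lam, hN, hrel hlt⟩ (hno η σ h0 hlt).1
    · exact (congrArg (ReachesV1 V) (attenuateBob_one_comp σ ⟨h0.le, h1⟩)).mpr
        ⟨hσ, n, m, d, lam, hN⟩
  · obtain ⟨hN, rfl⟩ := h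
    rcases h1.lt_or_eq with hlt | rfl
    · exact absurd ⟨hσ, n, m, d, lam, hN, hrel hlt⟩ (hno η σ h0 hlt).2
    · exact (congrArg (ReachesV1 V) (attenuateAlice_one_comp σ ⟨h0.le, h1⟩)).mpr
        ⟨hσ, m, n, d, lam, hN.of_swapModes⟩

/-- If one map to the normal form `V_1` is optimal, all are. -/
lemma ReachesV1.isOptimal {V : Mat4} (hV : Uncertain V) {κ σ : LocalTGCP} (hκ : ReachesV1 V κ)
    (hopt : IsOptimal V κ) (hσ : ReachesV1 V σ) : IsOptimal V σ := by
  obtain ⟨hκs, n, m, d, lam, hN⟩ := hκ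
  obtain ⟨hσs, n', m', d', lam', hN'⟩ := hσ
  have heq := hN.eq_criticalCM one_pos
  have heq' := hN'.eq_criticalCM one_pos
  have hVκ := heq ▸ hV.apply hκs
  have hminκ := ((isOptimal_iff hV κ).1 hopt).2
  obtain ⟨a1, a2, a3, a4, a5⟩ := multiplier_bounds_of_minimal hN.d2_pos hN.d1_pos hVκ (by
    intro S T
    rw [← heq, cost_apply hκs, cost_apply hκs, Matrix.one_mul, Matrix.one_mul]
    exact hminκ _ _)
  obtain ⟨i1, i2, i3, i4⟩ := criticalCM_one_invariants hκs heq
  obtain ⟨j1, j2, j3, j4⟩ := criticalCM_one_invariants hσs heq'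
  have e1 := hN.n1_pos; have e3 := hN.m1_pos
  have f1 := hN'.n1_pos; have f2 := hN'.n2_pos; have f3 := hN'.m1_pos; have f4 := hN'.m2_pos
  simp only [div_one, one_mul, one_pow] at e1 e3 f1 f3 a1 a2 a3 a4 a5 i1 i2 i3 i4 j1 j2 j3 j4
  have g1 := hN.d1_pos; have g2 := hN'.d1_pos
  simp only [div_one] at g1 g2
  have hsum := multipliers_sum_eq_of_invariants hN.d2_pos g1 a1 a2 a3 a4 a5 (by linarith)
    (by linarith) hN'.d2_pos g2 (by linarith) (by linarith) (by linarith) (by linarith)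
    (j1.trans i1.symm) (j2.trans i2.symm) (j3.trans i3.symm) (j4.trans i4.symm)
  -- A map to `V_1` has scalar bare noise and cost `α + β`, so equal sums of multipliers carry
  -- optimality from `κ` to `σ`.
  have hc : ∀ {ρ : LocalTGCP} (hρ : ρ.IsSymplectic) {α β d e : ℝ},
      ρ.apply V = criticalCM 1 α β d e → cost V ρ.alice.S ρ.bob.S = α + β ∧
        bareNoise (ρ.apply V) 1 1 = (α + β) • (1 : Mat2) := by
    intro ρ hρ α β d e h
    have h1 : bareNoise (ρ.apply V) 1 1 = (α + β) • (1 : Mat2) := by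
      have := bareNoise_criticalCM one_pos α β d e
      rw [h]; simpa using this
    refine ⟨?_, h1⟩
    have h2 := cost_apply hρ V 1 1
    rw [Matrix.one_mul, Matrix.one_mul] at h2
    rw [← h2, cost, halfTrace, h1]
    simp
  obtain ⟨c1, -⟩ := hc hκs heq
  obtain ⟨c2, c3⟩ := hc hσs heq'
  rw [← attenuateBob_one_comp σ ⟨zero_le_one, le_rfl⟩]
  refine isOptimal_attenuateBob_comp hV hσs one_pos le_rfl 
    ((congrArg (bareNoise (σ.apply V) 1) (one_smul ℝ (1 : Mat2))).trans c3) ?_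
  intro S T
  rw [cost_apply hσs, cost_apply hσs, one_smul ℝ (1 : Mat2), Matrix.one_mul, Matrix.one_mul, c2]
  refine le_trans (le_of_eq ?_) (hminκ _ _)
  rw [c1, div_one, div_one, one_mul, one_mul]
  exact hsum

end GaussianTeleportation
open GaussianTeleportation in
theorem theorem5 (V : Mat4) (hV : IsCM V) (hE : IsEntangled V) :
    -- an optimal map exists, and one of them is a local symplectic map to some `V_η`,
    -- followed by an attenuation of transmissivity `η` on one mode
    (∃ κ : LocalTGCP, IsCanonical V κ ∧ IsOptimal V κ) ∧
    -- every optimal map has this form, up to a joint phase rotation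
    (∀ ω : LocalTGCP, IsOptimal V ω →
      ∃ (κ : LocalTGCP) (θ : ℝ), IsCanonical V κ ∧ ω = (LocalTGCP.phaseRotation θ).comp κ) ∧
    -- if some `V_τ` with `τ < 1` satisfies the relation, the attenuation has to be added
    (∀ (τ : ℝ) (h0 : 0 < τ) (h1 : τ < 1) (σ : LocalTGCP), SolvesRelation V τ σ →
      IsOptimal V ((LocalTGCP.attenuateBob τ ⟨h0.le, h1.le⟩).comp σ) ∧
      ∀ ρ : LocalTGCP, ρ.IsSymplectic → ¬ IsOptimal V ρ) ∧
    (∀ (τ : ℝ) (h0 : 0 < τ) (h1 : τ < 1) (σ : LocalTGCP), SolvesRelationSwapped V τ σ →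
      IsOptimal V ((LocalTGCP.attenuateAlice τ ⟨h0.le, h1.le⟩).comp σ) ∧
      ∀ ρ : LocalTGCP, ρ.IsSymplectic → ¬ IsOptimal V ρ) ∧
    -- otherwise the optimum is the local symplectic map to `V_1`
    ((∀ (τ : ℝ) (σ : LocalTGCP), 0 < τ → τ < 1 →
        ¬ SolvesRelation V τ σ ∧ ¬ SolvesRelationSwapped V τ σ) →
      (∃ σ : LocalTGCP, ReachesV1 V σ) ∧
      (∀ σ : LocalTGCP, ReachesV1 V σ → IsOptimal V σ) ∧
      (∀ ω : LocalTGCP, IsOptimal V ω →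
        ∃ (σ : LocalTGCP) (θ : ℝ),
          ReachesV1 V σ ∧ ω = (LocalTGCP.phaseRotation θ).comp σ)) := by

  have hU := hV.uncertain
  have hI := hE.inseparable hU
  obtain ⟨ω₀, hω₀⟩ := exists_isOptimal hU
  obtain ⟨κ₀, θ₀, hκ₀, rfl⟩ := hω₀.exists_isCanonical hU hI
  -- Dropping the phase rotation keeps the fidelity, so the canonical map is itself optimal.
  rw [isOptimal_phaseRotation_comp] at hω₀
  refine ⟨⟨κ₀, hκ₀, hω₀⟩, fun ω hω => hω.exists_isCanonical hU hI,
    fun τ h0 h1 σ hσ => hσ.isOptimal hU hI h0 h1, fun τ h0 h1 σ hσ => ?_, fun hno => ?_⟩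
  · obtain ⟨h2, h3⟩ := hσ.swap.isOptimal hU.swapModes hI.swapModes h0 h1
    exact ⟨isOptimal_swapModes_iff.1 h2, fun ρ hρ hopt => h3 ρ.swap hρ.swap hopt.swap⟩
  · have hκ₁ := hκ₀.reachesV1 hno
    refine ⟨⟨κ₀, hκ₁⟩, fun σ hσ => hκ₁.isOptimal hU hω₀ hσ, fun ω hω => ?_⟩
    obtain ⟨κ, θ, hκ, h⟩ := hω.exists_isCanonical hU hI
    exact ⟨κ, θ, hκ.reachesV1 hno, h⟩
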